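/- Let $\Lambda\subset(0,\infty)$ be finite or countable. The ultrametric Urysohn space $\mathbb U=\mathbb U_\Lambda$ is the (unique up to isometry) complete separable ultrametric space whose set of nonzero distances is $\Lambda$ and such that, for all finite ultrametric spaces $S\subset Y$ with nonzero distances in $\Lambda$, each isometric embedding $S\to\mathbb U$ extends to an isometric embedding $Y\to\mathbb U$. Let $\mathbb I=\mathbb I_\Lambda$ be the group of isometries of $\mathbb U$ with the topology of pointwise convergence. A unitary representation of $\mathbb I$ is a homomorphism $\rho$ from $\mathbb I$ to the unitary group of a separable complex Hilbert space $H$, continuous in the strong operator topology. The objects of the category $\mathcal K_\Lambda$ are the nonempty finite ultrametric spaces with nonzero distances in $\Lambda$. A morphism $\mathfrak p:X\to Y$ is a triple $(P,p_+,p_-)$, where $P$ is an ultrametric space with nonzero distances in $\Lambda$ and $p_+:X\to P$, $p_-:Y\to P$ are isometric embeddings with $p_+(X)\cup p_-(Y)=P$; triples $(P,p_\pm)$ and $(P',p'_\pm)$ are identified if there is a bijective isometry $\pi:P\to P'$ with $p'_\pm=\pi\circ p_\pm$. The product $\mathfrak q\diamond\mathfrak p:X\to Z$ of $\mathfrak p=(P,p_\pm):X\to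 Y$ and $\mathfrak q=(Q,q_\pm):Y\to Z$ is $(R,p_+,q_-)$, where $P\Join Q$ is obtained from $P\sqcup Q$ by identifying $p_-(y)$ with $q_+(y)$ for all $y\in Y$, with the metric that extends those of $P$ and $Q$ and equals $d(a,b)=\min_{y\in Y}\max\bigl(d(a,p_-(y)),d(q_+(y),b)\bigr)$ for $a\in P$, $b\in Q$, and where $R=p_+(X)\cup q_-(Z)\subset P\Join Q$. The involution is $(P,p_+,p_-)^*=(P,p_-,p_+)$, and the unit $1_X$ is $(X,\mathrm{id},\mathrm{id})$. Fix an isometric embedding of each object of $\mathcal K_\Lambda$ into $\mathbb U$, and so regard objects as subsets of $\mathbb U$. Each $g\in\mathbb I$ determines a morphism $[g]_{X,Y}=(gX\cup Y,\ g|_X,\ \mathrm{id}_Y):X\to Y$, and $\operatorname{Mor}(X,Y)$ carries the quotient topology of the map $g\mapsto[g]_{X,Y}$ from $\mathbb I$ onto it. A continuous nondegenerate $*$-representation $\tau$ of $\mathcal K_\Lambda$ assigns to each object $X$ a separable complex Hilbert space $\tau(X)$ and to each $\mathfrak p\in\operatorname{Mor}(X,Y)$ a bounded linear operator $\tau(\mathfrak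 p):\tau(X)\to\tau(Y)$ such that $\tau(\mathfrak q\diamond\mathfrak p)=\tau(\mathfrak q)\tau(\mathfrak p)$, $\tau(\mathfrak p^*)=\tau(\mathfrak p)^*$, $\tau(1_X)=1_{\tau(X)}$, and the maps $\mathfrak p\mapsto\tau(\mathfrak p)$ are continuous from $\operatorname{Mor}(X,Y)$ to the weak operator topology. Two such representations $\tau,\tau'$ are equivalent if there are unitary operators $V_X:\tau(X)\to\tau'(X)$ with $V_Y\tau(\mathfrak p)=\tau'(\mathfrak p)V_X$ for all $\mathfrak p\in\operatorname{Mor}(X,Y)$. For a unitary representation $\rho$ of $\mathbb I$ in $H$ and an object $X\subset\mathbb U$, let $H[X]\subset H$ be the subspace of vectors fixed by the pointwise stabilizer of $X$ in $\mathbb I$, and let $\Pi[X]$ be the orthogonal projection of $H$ to $H[X]$. Put $\widehat\rho(X)=H[X]$ and $\widehat\rho([g]_{X,Y})=\Pi[Y]\,\rho(g)|_{H[X]}:H[X]\to H[Y]$. Theorem. For each unitary representation $\rho$ of $\mathbb I_\Lambda$, $\widehat\rho$ is a well-defined continuous nondegenerate $*$-representation of $\mathcal K_\Lambda$, and $\rho\mapsto\widehat\rho$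 induces a bijection from the set of unitary equivalence classes of unitary representations of $\mathbb I_\Lambda$ to the set of equivalence classes of continuous nondegenerate $*$-representations of $\mathcal K_\Lambda$. This bijection does not depend on the chosen embeddings of the objects into $\mathbb U$. -/

import Mathlib

universe u v

namespace UltraUrysohn

/-! ### The category of finite ultrametric spaces with spectrum in `Λ` -/

/-- Objects: nonempty finite ultrametric spaces whose nonzero distances belong to `Λ`. -/
structure KObj (Λ : Set ℝ) : Type (u + 1) where
  carrier : Type u
  [metric : MetricSpace carrier]
  [ultra : IsUltrametricDist carrier]
  [finite : Finite carrier]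
  [nonempty : Nonempty carrier]
  spectrum : ∀ x y : carrier, x ≠ y → dist x y ∈ Λ

instance (Λ : Set ℝ) : CoeSort (KObj.{u} Λ) (Type u) := ⟨KObj.carrier⟩

attribute [instance] KObj.metric KObj.ultra KObj.finite KObj.nonempty

variable {Λ : Set ℝ}

/-- Triples `(P, p₊, p₋)` representing morphisms `X → Y`. (As `P` is the union of the images of the
nonempty finite spaces `X` and `Y`, it is automatically finite and nonempty.) -/
structure Triple (X Y : KObj.{u} Λ) : Type (u + 1) where
  P : KObj.{u} Λ
  plus : X → P
  minus : Y → P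
  isometry_plus : Isometry plus
  isometry_minus : Isometry minus
  cover : Set.range plus ∪ Set.range minus = Set.univ

namespace Triple

/-- Two triples are equal as morphisms if they are related by an isometry `π : P → P'`. -/
def Same {X Y : KObj.{u} Λ} (p p' : Triple X Y) : Prop :=
  ∃ π : p.P ≃ᵢ p'.P, (∀ x, π (p.plus x) = p'.plus x) ∧ ∀ y, π (p.minus y) = p'.minus y

/-- The cross distances of a triple. -/
def cross {X Y : KObj.{u} Λ} (p : Triple X Y) (x : X) (y : Y) : ℝ := dist (p.plus x) (p.minus y)

theorem same_iff_cross {X Y : KObj.{u} Λ} (p p' : Triple X Y) :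
    p.Same p' ↔ ∀ x y, p.cross x y = p'.cross x y := by
  constructor
  · rintro ⟨π, h1, h2⟩ x y
    rw [cross, cross, ← h1, ← h2, π.isometry.dist_eq]
  · intro h
    let s : X ⊕ Y → p.P := Sum.elim p.plus p.minus
    let s' : X ⊕ Y → p'.P := Sum.elim p'.plus p'.minus
    have hs : Function.Surjective s := by
      intro a
      have : a ∈ Set.range p.plus ∪ Set.range p.minus := by rw [p.cover]; trivial
      rcases this with ⟨x, rfl⟩ | ⟨y, rfl⟩
      · exact ⟨Sum.inl x, rfl⟩
      · exact ⟨Sum.inr y, rfl⟩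
    have hs' : Function.Surjective s' := by
      intro a
      have : a ∈ Set.range p'.plus ∪ Set.range p'.minus := by rw [p'.cover]; trivial
      rcases this with ⟨x, rfl⟩ | ⟨y, rfl⟩
      · exact ⟨Sum.inl x, rfl⟩
      · exact ⟨Sum.inr y, rfl⟩
    have hd : ∀ a b, dist (s a) (s b) = dist (s' a) (s' b) := by
      rintro (a | a) (b | b)
      · simp [s, s', p.isometry_plus.dist_eq, p'.isometry_plus.dist_eq]
      · exact h a b
      · simpa [s, s', cross, dist_comm] using h b a
      · simp [s, s', p.isometry_minus.dist_eq, p'.isometry_minus.dist_eq]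
    let f : p.P → p'.P := fun a => s' (Function.surjInv hs a)
    have hf : ∀ a, f (s a) = s' a := by
      intro a
      rw [← dist_eq_zero, ← hd, Function.surjInv_eq hs, dist_self]
    have hfi : Isometry f := by
      refine Isometry.of_dist_eq fun a b => ?_
      obtain ⟨a, rfl⟩ := hs a
      obtain ⟨b, rfl⟩ := hs b
      rw [hf, hf, hd]
    have hfs : Function.Surjective f := by
      intro a
      obtain ⟨a, rfl⟩ := hs' a
      exact ⟨s a, hf a⟩
    exact ⟨⟨Equiv.ofBijective f ⟨hfi.injective, hfs⟩, hfi⟩,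
      fun x => hf (Sum.inl x), fun y => hf (Sum.inr y)⟩

instance setoid (X Y : KObj.{u} Λ) : Setoid (Triple X Y) where
  r := Same
  iseqv := by
    refine ⟨fun p => ?_, fun {p q} h => ?_, fun {p q r} h h' => ?_⟩
    · exact (same_iff_cross _ _).2 fun _ _ => rfl
    · exact (same_iff_cross _ _).2 fun x y => ((same_iff_cross _ _).1 h x y).symm
    · exact (same_iff_cross _ _).2 fun x y =>
        ((same_iff_cross _ _).1 h x y).trans ((same_iff_cross _ _).1 h' x y)

section Gluing

variable {X Y Z : KObj.{u} Λ} (p : Triple X Y) (q : Triple Y Z)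

/-- The amalgamated distance on `P ⊔ Q`; for points in different pieces it is
`min_y max (d(a, p₋ y), d(q₊ y, b))`. -/
noncomputable def glueDist : p.P ⊕ q.P → p.P ⊕ q.P → ℝ
  | .inl a, .inl b => dist a b
  | .inr a, .inr b => dist a b
  | .inl a, .inr b => ⨅ y : Y, max (dist a (p.minus y)) (dist (q.plus y) b)
  | .inr b, .inl a => ⨅ y : Y, max (dist a (p.minus y)) (dist (q.plus y) b)

theorem glue_le (a : p.P) (b : q.P) (y : Y) :
    glueDist p q (.inl a) (.inr b) ≤ max (dist a (p.minus y)) (dist (q.plus y) b) :=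
  ciInf_le (Set.finite_range _).bddBelow y

theorem glue_attained (a : p.P) (b : q.P) :
    ∃ y, glueDist p q (.inl a) (.inr b) = max (dist a (p.minus y)) (dist (q.plus y) b) := by
  obtain ⟨y, hy⟩ := exists_eq_ciInf_of_finite
    (f := fun y : Y => max (dist a (p.minus y)) (dist (q.plus y) b))
  exact ⟨y, hy.symm⟩

theorem glue_comm (a b : p.P ⊕ q.P) : glueDist p q a b = glueDist p q b a := by
  rcases a with a | a <;> rcases b with b | b <;> simp [glueDist, dist_comm]

theorem glue_self (a : p.P ⊕ q.P) : glueDist p q a a = 0 := by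
  rcases a with a | a <;> simp [glueDist]

theorem glue_ultra (a b c : p.P ⊕ q.P) :
    glueDist p q a c ≤ max (glueDist p q a b) (glueDist p q b c) := by
  have hpq : ∀ y y', dist (p.minus y) (p.minus y') = dist (q.plus y) (q.plus y') := fun y y' => by
    rw [p.isometry_minus.dist_eq, q.isometry_plus.dist_eq]
  have tp : ∀ x y z : p.P, dist x z ≤ max (dist x y) (dist y z) := IsUltrametricDist.dist_triangle_max
  have tq : ∀ x y z : q.P, dist x z ≤ max (dist x y) (dist y z) := IsUltrametricDist.dist_triangle_max
  rcases a with a | a <;> rcases b with b | b <;> rcases c with c | c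
  · exact tp a b c
  · obtain ⟨y, hy⟩ := glue_attained p q b c
    have h1 := glue_le p q a c y
    have h2 := tp a b (p.minus y)
    rw [hy]
    change _ ≤ max (dist a b) _
    grind
  · obtain ⟨y, hy⟩ := glue_attained p q a b
    obtain ⟨y', hy'⟩ := glue_attained p q c b
    rw [glue_comm p q (.inr b), hy, hy']
    change dist a c ≤ _
    have h1 := tp a (p.minus y) c
    have h2 := tp (p.minus y) (p.minus y') c
    have h3 := hpq y y'
    have h4 := tq (q.plus y) b (q.plus y')
    rw [dist_comm b] at h4
    rw [dist_comm (p.minus y') c] at h2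
    clear tp tq hpq
    grind
  · obtain ⟨y, hy⟩ := glue_attained p q a b
    have h1 := glue_le p q a c y
    have h2 := tq (q.plus y) b c
    rw [hy]
    change _ ≤ max _ (dist b c)
    grind
  · obtain ⟨y, hy⟩ := glue_attained p q b a
    have h1 := glue_le p q c a y
    have h2 := tp c b (p.minus y)
    rw [glue_comm p q (.inr a) (.inl c), glue_comm p q (.inr a) (.inl b), hy]
    change _ ≤ max _ (dist b c)
    rw [dist_comm c b] at h2
    grind
  · obtain ⟨y, hy⟩ := glue_attained p q b a
    obtain ⟨y', hy'⟩ := glue_attained p q b c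
    rw [glue_comm p q (.inr a) (.inl b), hy, hy']
    change dist a c ≤ _
    have h1 := tq a (q.plus y) c
    have h2 := tq (q.plus y) (q.plus y') c
    have h3 := hpq y y'
    have h4 := tp (p.minus y) b (p.minus y')
    rw [dist_comm (p.minus y) b] at h4
    rw [dist_comm a (q.plus y)] at h1
    clear tp tq hpq
    grind
  · obtain ⟨y, hy⟩ := glue_attained p q c b
    have h1 := glue_le p q c a y
    have h2 := tq (q.plus y) b a
    rw [glue_comm p q (.inr a) (.inl c), glue_comm p q (.inr b) (.inl c), hy]
    change _ ≤ max (dist a b) _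
    rw [dist_comm b a] at h2
    grind
  · exact tq a b c

theorem glue_nonneg (a b : p.P ⊕ q.P) : 0 ≤ glueDist p q a b := by
  have := glue_ultra p q a b a
  rw [glue_self, glue_comm p q b a, max_self] at this
  exact this

/-- The disjoint union `P ⊔ Q` with the amalgamated pseudometric. -/
def Glue : Type u := p.P ⊕ q.P

noncomputable instance : PseudoMetricSpace (Glue p q) where
  dist := glueDist p q
  dist_self := glue_self p q
  dist_comm := glue_comm p q
  dist_triangle a b c := (glue_ultra p q a b c).trans
    (max_le_add_of_nonneg (glue_nonneg p q a b) (glue_nonneg p q b c))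

/-- The amalgam `P ⋈ Q`: points of `P ⊔ Q` at distance zero are identified, which means that
`p₋ y` is identified with `q₊ y` for each `y` (see `amalgam_eq_iff`). -/
abbrev Amalgam : Type u := SeparationQuotient (Glue p q)

/-- The canonical map `P → P ⋈ Q`. -/
noncomputable def amalgamInl (a : p.P) : Amalgam p q := SeparationQuotient.mk (Sum.inl a : p.P ⊕ q.P)

/-- The canonical map `Q → P ⋈ Q`. -/
noncomputable def amalgamInr (b : q.P) : Amalgam p q := SeparationQuotient.mk (Sum.inr b : p.P ⊕ q.P)

theorem dist_inl_inl (a b : p.P) : dist (amalgamInl p q a) (amalgamInl p q b) = dist a b := rfl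

theorem dist_inr_inr (a b : q.P) : dist (amalgamInr p q a) (amalgamInr p q b) = dist a b := rfl

theorem dist_inl_inr (a : p.P) (b : q.P) : dist (amalgamInl p q a) (amalgamInr p q b) =
    ⨅ y : Y, max (dist a (p.minus y)) (dist (q.plus y) b) := rfl

theorem amalgam_eq_iff (a : p.P) (b : q.P) :
    amalgamInl p q a = amalgamInr p q b ↔ ∃ y, a = p.minus y ∧ q.plus y = b := by
  rw [← dist_eq_zero]
  constructor
  · intro h
    obtain ⟨y, hy⟩ := glue_attained p q a b
    have h0 : max (dist a (p.minus y)) (dist (q.plus y) b) = 0 := hy.symm.trans h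
    have h1 := le_max_left (dist a (p.minus y)) (dist (q.plus y) b)
    have h2 := le_max_right (dist a (p.minus y)) (dist (q.plus y) b)
    rw [h0] at h1 h2
    exact ⟨y, dist_le_zero.1 h1, dist_le_zero.1 h2⟩
  · rintro ⟨y, rfl, rfl⟩
    refine le_antisymm ((glue_le p q _ _ y).trans ?_) dist_nonneg
    simp

instance : IsUltrametricDist (Amalgam p q) where
  dist_triangle_max a b c := by
    obtain ⟨a, rfl⟩ := SeparationQuotient.surjective_mk a
    obtain ⟨b, rfl⟩ := SeparationQuotient.surjective_mk b
    obtain ⟨c, rfl⟩ := SeparationQuotient.surjective_mk c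
    exact glue_ultra p q a b c

instance : Finite (Amalgam p q) :=
  haveI : Finite (Glue p q) := inferInstanceAs (Finite (p.P ⊕ q.P))
  Finite.of_surjective _ SeparationQuotient.surjective_mk

theorem amalgam_spectrum (a b : Amalgam p q) (hab : a ≠ b) : dist a b ∈ Λ := by
  have key : ∀ (a : p.P) (b : q.P), amalgamInl p q a ≠ amalgamInr p q b →
      dist (amalgamInl p q a) (amalgamInr p q b) ∈ Λ := by
    intro a b h
    obtain ⟨y, hy⟩ := glue_attained p q a b
    have hd : dist (amalgamInl p q a) (amalgamInr p q b) =
      max (dist a (p.minus y)) (dist (q.plus y) b) := hy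
    have hpos := dist_pos.2 h
    rw [hd] at hpos ⊢
    rcases max_cases (dist a (p.minus y)) (dist (q.plus y) b) with ⟨h1, _⟩ | ⟨h1, _⟩
    · rw [h1] at hpos ⊢
      exact p.P.spectrum _ _ (dist_pos.1 hpos)
    · rw [h1] at hpos ⊢
      exact q.P.spectrum _ _ (dist_pos.1 hpos)
  obtain ⟨a, rfl⟩ := SeparationQuotient.surjective_mk a
  obtain ⟨b, rfl⟩ := SeparationQuotient.surjective_mk b
  rcases a with a | a <;> rcases b with b | b
  · exact p.P.spectrum a b fun h => hab (by rw [h])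
  · exact key a b hab
  · rw [dist_comm]
    exact key b a hab.symm
  · exact q.P.spectrum a b fun h => hab (by rw [h])

/-- The space `R = p₊(X) ∪ q₋(Z) ⊆ P ⋈ Q`. -/
noncomputable def compSpace : KObj.{u} Λ where
  carrier := {a : Amalgam p q // a ∈ Set.range (fun x => amalgamInl p q (p.plus x)) ∪
    Set.range (fun z => amalgamInr p q (q.minus z))}
  nonempty := ⟨⟨amalgamInl p q (p.plus (Classical.arbitrary X)), Or.inl ⟨_, rfl⟩⟩⟩
  spectrum a b hab := amalgam_spectrum p q a b fun h => hab (Subtype.ext h)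

/-- The product of two triples. -/
noncomputable def comp : Triple X Z where
  P := compSpace p q
  plus x := ⟨amalgamInl p q (p.plus x), Or.inl ⟨x, rfl⟩⟩
  minus z := ⟨amalgamInr p q (q.minus z), Or.inr ⟨z, rfl⟩⟩
  isometry_plus := Isometry.of_dist_eq fun x x' => p.isometry_plus.dist_eq x x'
  isometry_minus := Isometry.of_dist_eq fun z z' => q.isometry_minus.dist_eq z z'
  cover := by
    refine Set.eq_univ_of_forall ?_
    rintro ⟨a, ⟨x, rfl⟩ | ⟨z, rfl⟩⟩
    · exact Or.inl ⟨x, rfl⟩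
    · exact Or.inr ⟨z, rfl⟩

theorem comp_cross (x : X) (z : Z) :
    (comp p q).cross x z = ⨅ y : Y, max (p.cross x y) (q.cross y z) := rfl

theorem comp_cross_le (x : X) (y : Y) (z : Z) :
    (comp p q).cross x z ≤ max (p.cross x y) (q.cross y z) :=
  glue_le p q _ _ y

theorem comp_cross_attained (x : X) (z : Z) :
    ∃ y, (comp p q).cross x z = max (p.cross x y) (q.cross y z) :=
  glue_attained p q _ _

end Gluing

/-- The unit triple. -/
def one (X : KObj.{u} Λ) : Triple X X where
  P := X
  plus := id
  minus := id
  isometry_plus := isometry_id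
  isometry_minus := isometry_id
  cover := by simp

/-- The involution on triples. -/
def star {X Y : KObj.{u} Λ} (p : Triple X Y) : Triple Y X where
  P := p.P
  plus := p.minus
  minus := p.plus
  isometry_plus := p.isometry_minus
  isometry_minus := p.isometry_plus
  cover := by rw [Set.union_comm, p.cover]

end Triple

/-- The category `K_Λ`. -/
noncomputable instance : CategoryTheory.Category (KObj.{u} Λ) where
  Hom X Y := Quotient (Triple.setoid X Y)
  id X := Quotient.mk _ (Triple.one X)
  comp := Quotient.map₂ Triple.comp (by
    intro p p' hp q q' hq
    refine (Triple.same_iff_cross _ _).2 fun x z => ?_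
    simp only [Triple.comp_cross, (Triple.same_iff_cross _ _).1 hp,
      (Triple.same_iff_cross _ _).1 hq])
  id_comp {X Y} f := by
    induction f using Quotient.inductionOn with | _ p
    refine Quotient.sound ((Triple.same_iff_cross _ _).2 fun x y => le_antisymm ?_ ?_)
    · refine (Triple.comp_cross_le _ _ x x y).trans ?_
      exact max_le ((dist_self x).le.trans dist_nonneg) le_rfl
    · obtain ⟨x', h⟩ := Triple.comp_cross_attained (Triple.one X) p x y
      rw [h]
      refine (IsUltrametricDist.dist_triangle_max _ (p.plus x') _).trans ?_
      rw [p.isometry_plus.dist_eq]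
      rfl
  comp_id {X Y} f := by
    induction f using Quotient.inductionOn with | _ p
    refine Quotient.sound ((Triple.same_iff_cross _ _).2 fun x y => le_antisymm ?_ ?_)
    · refine (Triple.comp_cross_le _ _ x y y).trans ?_
      exact max_le le_rfl ((dist_self y).le.trans dist_nonneg)
    · obtain ⟨y', h⟩ := Triple.comp_cross_attained p (Triple.one Y) x y
      rw [h]
      refine (IsUltrametricDist.dist_triangle_max _ (p.minus y') _).trans ?_
      rw [p.isometry_minus.dist_eq]
      rfl
  assoc {X Y Z W} f g h := by
    induction f using Quotient.inductionOn with | _ p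
    induction g using Quotient.inductionOn with | _ q
    induction h using Quotient.inductionOn with | _ r
    refine Quotient.sound ((Triple.same_iff_cross _ _).2 fun x w => le_antisymm ?_ ?_)
    · obtain ⟨y, h1⟩ := Triple.comp_cross_attained p (q.comp r) x w
      obtain ⟨z, h2⟩ := Triple.comp_cross_attained q r y w
      have h3 := Triple.comp_cross_le (p.comp q) r x z w
      have h4 := Triple.comp_cross_le p q x y z
      grind
    · obtain ⟨z, h1⟩ := Triple.comp_cross_attained (p.comp q) r x w
      obtain ⟨y, h2⟩ := Triple.comp_cross_attained p q x z
      have h3 := Triple.comp_cross_le p (q.comp r) x y w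
      have h4 := Triple.comp_cross_le q r y z w
      grind

/-- The involution of the category `K_Λ`. -/
def morStar {X Y : KObj.{u} Λ} : (X ⟶ Y) → (Y ⟶ X) :=
  Quotient.map Triple.star (by
    rintro p p' ⟨π, h1, h2⟩
    exact ⟨π, h2, h1⟩)

/-! ### Ultrametric Urysohn spaces and their isometry groups -/

/-- `U` is the ultrametric Urysohn space with spectrum `Λ`: a complete separable ultrametric space
with set of nonzero distances `Λ` such that, for finite ultrametric spaces `S ⊆ Y` with distances in
`Λ`, each isometric embedding `S → U` extends to an isometric embedding `Y → U`. -/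
class IsUrysohn (Λ : Set ℝ) (U : Type u) [MetricSpace U] : Prop where
  ultra : IsUltrametricDist U
  complete : CompleteSpace U
  separable : TopologicalSpace.SeparableSpace U
  spectrum : {r : ℝ | ∃ x y : U, x ≠ y ∧ dist x y = r} = Λ
  extension : ∀ (Y : Type u) [MetricSpace Y] [IsUltrametricDist Y] [Finite Y],
    (∀ x y : Y, x ≠ y → dist x y ∈ Λ) → ∀ (S : Set Y) (f : S → U), Isometry f →
      ∃ F : Y → U, Isometry F ∧ ∀ s : S, F s = f s

/-- The topology of pointwise convergence on the group of isometries. -/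
instance isometryTopology (U : Type u) [MetricSpace U] : TopologicalSpace (U ≃ᵢ U) :=
  TopologicalSpace.induced (fun g : U ≃ᵢ U => (g : U → U)) inferInstance

/-- Isometric embeddings of an object of `K_Λ` into `U`. -/
structure IsoEmb (X : KObj.{u} Λ) (U : Type u) [MetricSpace U] : Type u where
  toFun : X → U
  isometry : Isometry toFun

section Urysohn

variable {U : Type u} [MetricSpace U] [IsUrysohn Λ U]

theorem IsUrysohn.dist_mem {x y : U} (h : x ≠ y) : dist x y ∈ Λ := by
  rw [← IsUrysohn.spectrum (Λ := Λ) (U := U)]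
  exact ⟨x, y, h, rfl⟩

theorem IsUrysohn.nonempty_isoEmb (X : KObj.{u} Λ) : Nonempty (IsoEmb X U) := by
  obtain ⟨F, hF, -⟩ := IsUrysohn.extension (Λ := Λ) (U := U) X X.spectrum ∅
    (fun s => s.2.elim) (fun s => s.2.elim)
  exact ⟨⟨F, hF⟩⟩

/-- The space `g X ∪ Y ⊆ U`, where `X` and `Y` are identified with subsets of `U`. -/
def unionSpace {X Y : KObj.{u} Λ} (a : IsoEmb X U) (b : IsoEmb Y U) (g : U ≃ᵢ U) : KObj.{u} Λ :=
  haveI : IsUltrametricDist U := IsUrysohn.ultra Λ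
  { carrier := {u : U // u ∈ Set.range (fun x => g (a.toFun x)) ∪ Set.range b.toFun}
    nonempty := ⟨⟨g (a.toFun (Classical.arbitrary X)), Or.inl ⟨_, rfl⟩⟩⟩
    spectrum := fun x y h =>
      IsUrysohn.dist_mem (U := U) (x := x.1) (y := y.1) fun h' => h (Subtype.ext h') }

/-- The morphism `X → Y` determined by an isometry `g` of `U`: the space `g X ∪ Y` with the
embeddings `g|_X` and `id|_Y`. -/
def isometryMor {X Y : KObj.{u} Λ} (a : IsoEmb X U) (b : IsoEmb Y U) (g : U ≃ᵢ U) : X ⟶ Y :=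
  Quotient.mk (Triple.setoid X Y)
    { P := unionSpace a b g
      plus := fun x => ⟨g (a.toFun x), Or.inl ⟨x, rfl⟩⟩
      minus := fun y => ⟨b.toFun y, Or.inr ⟨y, rfl⟩⟩
      isometry_plus := g.isometry.comp a.isometry
      isometry_minus := b.isometry
      cover := by
        refine Set.eq_univ_of_forall ?_
        rintro ⟨u, ⟨x, rfl⟩ | ⟨y, rfl⟩⟩
        · exact Or.inl ⟨x, rfl⟩
        · exact Or.inr ⟨y, rfl⟩ }

/-- The topology on `Mor(X, Y)` as a quotient of the group of isometries of `U`. -/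
abbrev morTopology {X Y : KObj.{u} Λ} (a : IsoEmb X U) (b : IsoEmb Y U) : TopologicalSpace (X ⟶ Y) :=
  TopologicalSpace.coinduced (isometryMor a b) inferInstance

end Urysohn

/-! ### Unitary representations and `*`-representations -/

/-- Separable complex Hilbert spaces. -/
structure Hilb : Type (v + 1) where
  carrier : Type v
  [normed : NormedAddCommGroup carrier]
  [inner : InnerProductSpace ℂ carrier]
  [complete : CompleteSpace carrier]
  [separable : TopologicalSpace.SeparableSpace carrier]

instance : CoeSort Hilb.{v} (Type v) := ⟨Hilb.carrier⟩

attribute [instance] Hilb.normed Hilb.inner Hilb.complete Hilb.separable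

/-- Unitary representations of the group of isometries of `U`, continuous in the strong operator
topology. -/
structure UnitaryRep (U : Type u) [MetricSpace U] : Type (max u (v + 1)) where
  space : Hilb.{v}
  hom : (U ≃ᵢ U) →* (space ≃ₗᵢ[ℂ] space)
  continuous_hom : ∀ ξ : space, Continuous fun g => hom g ξ

namespace UnitaryRep

variable {U : Type u} [MetricSpace U]

/-- Unitary equivalence of unitary representations. -/
instance setoid (U : Type u) [MetricSpace U] : Setoid (UnitaryRep.{u, v} U) where
  r ρ ρ' := ∃ V : ρ.space ≃ₗᵢ[ℂ] ρ'.space, ∀ g ξ, V (ρ.hom g ξ) = ρ'.hom g (V ξ)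
  iseqv := by
    refine ⟨fun ρ => ⟨LinearIsometryEquiv.refl ℂ _, fun _ _ => rfl⟩, ?_, ?_⟩
    · rintro ρ ρ' ⟨V, hV⟩
      refine ⟨V.symm, fun g ξ => ?_⟩
      rw [LinearIsometryEquiv.symm_apply_eq, hV, LinearIsometryEquiv.apply_symm_apply]
    · rintro ρ ρ' ρ'' ⟨V, hV⟩ ⟨W, hW⟩
      exact ⟨V.trans W, fun g ξ => by simp [hV, hW]⟩

variable (ρ : UnitaryRep.{u, v} U)

/-- The space `H[S]` of vectors fixed by the pointwise stabilizer of `S`. -/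
def fixedSubmodule (S : Set U) : Submodule ℂ ρ.space where
  carrier := {ξ | ∀ g : U ≃ᵢ U, (∀ s ∈ S, g s = s) → ρ.hom g ξ = ξ}
  add_mem' hξ hη g hg := by rw [map_add, hξ g hg, hη g hg]
  zero_mem' g _ := map_zero _
  smul_mem' c ξ hξ g hg := by rw [map_smul, hξ g hg]

theorem isClosed_fixedSubmodule (S : Set U) : IsClosed (ρ.fixedSubmodule S : Set ρ.space) := by
  have : (ρ.fixedSubmodule S : Set ρ.space) =
      ⋂ (g : U ≃ᵢ U) (_ : ∀ s ∈ S, g s = s), {ξ | ρ.hom g ξ = ξ} := by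
    ext ξ
    simp [fixedSubmodule]
  rw [this]
  exact isClosed_iInter fun g => isClosed_iInter fun _ =>
    isClosed_eq (ρ.hom g).continuous continuous_id

instance (S : Set U) : CompleteSpace (ρ.fixedSubmodule S) :=
  (ρ.isClosed_fixedSubmodule S).completeSpace_coe

/-- `H[S]` as a Hilbert space. -/
noncomputable def fixed (S : Set U) : Hilb.{v} where
  carrier := ρ.fixedSubmodule S
  separable :=
    haveI := UniformSpace.secondCountable_of_separable ρ.space
    inferInstance

/-- The operator `Π[T] ρ(g) : H[S] → H[T]`. -/
noncomputable def reducedOp (S T : Set U) (g : U ≃ᵢ U) : ρ.fixed S →L[ℂ] ρ.fixed T :=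
  (ρ.fixedSubmodule T).orthogonalProjectionOnto ∘L
    ((ρ.hom g).toContinuousLinearEquiv : ρ.space →L[ℂ] ρ.space) ∘L (ρ.fixedSubmodule S).subtypeL

end UnitaryRep

/-- An assignment of a Hilbert space to each object of `K_Λ` and of a bounded operator to each
morphism. -/
structure OperatorFamily (Λ : Set ℝ) : Type (max (u + 1) (v + 1)) where
  space : KObj.{u} Λ → Hilb.{v}
  op : ∀ X Y : KObj.{u} Λ, (X ⟶ Y) → (space X →L[ℂ] space Y)

open CategoryTheory in
/-- Continuous nondegenerate `*`-representations of the category `K_Λ`. -/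
structure StarRep (Λ : Set ℝ) (U : Type u) [MetricSpace U] [IsUrysohn Λ U] :
    Type (max (u + 1) (v + 1)) extends OperatorFamily.{u, v} Λ where
  op_comp : ∀ (X Y Z : KObj.{u} Λ) (p : X ⟶ Y) (q : Y ⟶ Z), op X Z (p ≫ q) = op Y Z q ∘L op X Y p
  op_star : ∀ (X Y : KObj.{u} Λ) (p : X ⟶ Y), (op X Y p).adjoint = op Y X (morStar p)
  nondegenerate : ∀ X : KObj.{u} Λ, op X X (𝟙 X) = ContinuousLinearMap.id ℂ (space X)
  /-- Continuity from the quotient topology on `Mor(X, Y)` to the weak operator topology. -/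
  continuous_op : ∀ (X Y : KObj.{u} Λ) (a : IsoEmb X U) (b : IsoEmb Y U)
    (ξ : space X) (η : space Y),
    @Continuous _ _ (morTopology a b) _ fun p : X ⟶ Y => inner ℂ η (op X Y p ξ)

/-- Unitary equivalence of representations of `K_Λ`. -/
instance StarRep.setoid (Λ : Set ℝ) (U : Type u) [MetricSpace U] [IsUrysohn Λ U] :
    Setoid (StarRep.{u, v} Λ U) where
  r τ τ' := ∃ V : ∀ X, τ.space X ≃ₗᵢ[ℂ] τ'.space X,
    ∀ (X Y : KObj.{u} Λ) (p : X ⟶ Y) (ξ : τ.space X), V Y (τ.op X Y p ξ) = τ'.op X Y p (V X ξ)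
  iseqv := by
    refine ⟨fun τ => ⟨fun X => LinearIsometryEquiv.refl ℂ _, fun _ _ _ _ => rfl⟩, ?_, ?_⟩
    · rintro τ τ' ⟨V, hV⟩
      refine ⟨fun X => (V X).symm, fun X Y p ξ => ?_⟩
      rw [LinearIsometryEquiv.symm_apply_eq, hV, LinearIsometryEquiv.apply_symm_apply]
    · rintro τ τ' τ'' ⟨V, hV⟩ ⟨W, hW⟩
      exact ⟨fun X => (V X).trans (W X), fun X Y p ξ => by simp [hV, hW]⟩

/-- `D` is the family `ρ̂`, where the objects of `K_Λ` are identified with subsets of `U` by means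
of `e`: the space of `X` is `H[X]`, and the operator of the morphism determined by an isometry `g`
is `Π[Y] ρ(g) : H[X] → H[Y]`. -/
def IsReduction {U : Type u} [MetricSpace U] [IsUrysohn Λ U] (e : ∀ X : KObj.{u} Λ, IsoEmb X U)
    (ρ : UnitaryRep.{u, v} U) (D : OperatorFamily.{u, v} Λ) : Prop :=
  ∃ op : ∀ X Y : KObj.{u} Λ, (X ⟶ Y) →
      (ρ.fixed (Set.range (e X).toFun) →L[ℂ] ρ.fixed (Set.range (e Y).toFun)),
    D = ⟨fun X => ρ.fixed (Set.range (e X).toFun), op⟩ ∧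
    ∀ (X Y : KObj.{u} Λ) (g : U ≃ᵢ U), op X Y (isometryMor (e X) (e Y) g) =
      ρ.reducedOp (Set.range (e X).toFun) (Set.range (e Y).toFun) g

/-! ### The standard model of the Urysohn space -/

/-- Functions `ω : Λ → ℤ` whose support is finite or a sequence convergent to `0`. -/
structure Model (Λ : Set ℝ) : Type where
  toFun : Λ → ℤ
  support : ∀ ε : ℝ, 0 < ε → {l : Λ | ε ≤ l ∧ toFun l ≠ 0}.Finite

namespace Model

variable {Λ : Set ℝ}

theorem ext {ω ω' : Model Λ} (h : ∀ l, ω.toFun l = ω'.toFun l) : ω = ω' := by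
  cases ω
  cases ω'
  congr
  exact funext h

/-- The distance is the largest `λ ∈ Λ` with `ω(λ) ≠ ω'(λ)` (and `0` if `ω = ω'`). -/
noncomputable def mdist (ω ω' : Model Λ) : ℝ :=
  sSup ((fun l : Λ => (l : ℝ)) '' {l | ω.toFun l ≠ ω'.toFun l})

theorem mdist_self (ω : Model Λ) : mdist ω ω = 0 := by simp [mdist]

theorem mdist_comm (ω ω' : Model Λ) : mdist ω ω' = mdist ω' ω := by
  simp only [mdist, ne_comm]

variable [hΛ : Fact (Λ ⊆ Set.Ioi 0)]

theorem lam_pos (l : Λ) : (0 : ℝ) < l := hΛ.out l.2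

theorem exists_max (ω ω' : Model Λ) (h : ω ≠ ω') : ∃ l : Λ, ω.toFun l ≠ ω'.toFun l ∧
    ∀ m : Λ, ω.toFun m ≠ ω'.toFun m → m ≤ l := by
  obtain ⟨l₀, hl₀⟩ : ∃ l, ω.toFun l ≠ ω'.toFun l := by
    by_contra! h'
    exact h (ext h')
  have hfin : {l : Λ | (l₀ : ℝ) ≤ l ∧ ω.toFun l ≠ ω'.toFun l}.Finite := by
    refine ((ω.support l₀ (lam_pos l₀)).union (ω'.support l₀ (lam_pos l₀))).subset ?_
    rintro l ⟨h1, h2⟩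
    by_cases h3 : ω.toFun l = 0
    · exact Or.inr ⟨h1, fun h4 => h2 (h3.trans h4.symm)⟩
    · exact Or.inl ⟨h1, h3⟩
  obtain ⟨l, ⟨hl1, hl2⟩, hl3⟩ := hfin.exists_maximal ⟨l₀, le_rfl, hl₀⟩
  refine ⟨l, hl2, fun m hm => ?_⟩
  by_contra! hlt
  exact absurd (hl3 ⟨hl1.trans (le_of_lt hlt), hm⟩ hlt.le) (not_le.2 hlt)

theorem mdist_eq (ω ω' : Model Λ) (l : Λ) (h1 : ω.toFun l ≠ ω'.toFun l)
    (h2 : ∀ m : Λ, ω.toFun m ≠ ω'.toFun m → m ≤ l) : mdist ω ω' = l := by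
  refine IsGreatest.csSup_eq ⟨⟨l, h1, rfl⟩, ?_⟩
  rintro _ ⟨m, hm, rfl⟩
  exact h2 m hm

theorem mdist_le_iff (ω ω' : Model Λ) {r : ℝ} (hr : 0 ≤ r) :
    mdist ω ω' ≤ r ↔ ∀ l : Λ, r < l → ω.toFun l = ω'.toFun l := by
  by_cases h : ω = ω'
  · subst h
    simp [mdist_self, hr]
  · obtain ⟨l, h1, h2⟩ := exists_max ω ω' h
    rw [mdist_eq ω ω' l h1 h2]
    constructor
    · intro h3 m hm
      by_contra h4
      exact absurd (Subtype.coe_le_coe.2 (h2 m h4)) (not_le.2 (h3.trans_lt hm))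
    · intro h3
      by_contra! h4
      exact h1 (h3 l h4)

theorem mdist_nonneg (ω ω' : Model Λ) : 0 ≤ mdist ω ω' := by
  refine Real.sSup_nonneg ?_
  rintro _ ⟨l, -, rfl⟩
  exact (lam_pos l).le

theorem mdist_ultra (a b c : Model Λ) : mdist a c ≤ max (mdist a b) (mdist b c) := by
  rw [mdist_le_iff _ _ (le_max_of_le_left (mdist_nonneg a b))]
  intro l hl
  rw [(mdist_le_iff a b (mdist_nonneg a b)).1 le_rfl l ((le_max_left _ _).trans_lt hl),
    (mdist_le_iff b c (mdist_nonneg b c)).1 le_rfl l ((le_max_right _ _).trans_lt hl)]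

noncomputable instance : MetricSpace (Model Λ) where
  dist := mdist
  dist_self := mdist_self
  dist_comm := mdist_comm
  dist_triangle a b c := (mdist_ultra a b c).trans
    (max_le_add_of_nonneg (mdist_nonneg a b) (mdist_nonneg b c))
  eq_of_dist_eq_zero {a b} h := ext fun l =>
    (mdist_le_iff a b le_rfl).1 (le_of_eq h) l (lam_pos l)

theorem dist_le_iff' (a b : Model Λ) {r : ℝ} (hr : 0 ≤ r) :
    dist a b ≤ r ↔ ∀ l : Λ, r < l → a.toFun l = b.toFun l := mdist_le_iff a b hr

theorem dist_eq_of (ω ω' : Model Λ) (l : Λ) (h1 : ω.toFun l ≠ ω'.toFun l)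
    (h2 : ∀ m : Λ, l < m → ω.toFun m = ω'.toFun m) : dist ω ω' = l := by
  refine mdist_eq ω ω' l h1 fun m hm => ?_
  by_contra! h
  exact hm (h2 m h)

instance : IsUltrametricDist (Model Λ) := ⟨mdist_ultra⟩

instance : CompleteSpace (Model Λ) := by
  refine Metric.complete_of_cauchySeq_tendsto fun s hs => ?_
  have hN : ∀ ε : ℝ, 0 < ε → ∃ N, ∀ n ≥ N, ∀ l : Λ, ε < l →
      (s n).toFun l = (s N).toFun l := by
    intro ε hε
    obtain ⟨N, hN⟩ := Metric.cauchySeq_iff'.1 hs ε hε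
    exact ⟨N, fun n hn => (dist_le_iff' _ _ hε.le).1 (hN n hn).le⟩
  choose N hN using hN
  have hhalf : ∀ l : Λ, (0 : ℝ) < l / 2 := fun l => half_pos (lam_pos l)
  let f : Λ → ℤ := fun l => (s (N (l / 2) (hhalf l))).toFun l
  have hf : ∀ (ε : ℝ) (hε : 0 < ε) (n : ℕ), N ε hε ≤ n → ∀ l : Λ, ε < l →
      (s n).toFun l = f l := by
    intro ε hε n hn l hl
    have h1 := hN ε hε n hn l hl
    have h2 := hN ε hε (max n (N (l / 2) (hhalf l))) (hn.trans (le_max_left _ _)) l hl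
    have h3 := hN (l / 2) (hhalf l) (max n (N (l / 2) (hhalf l))) (le_max_right _ _) l
      (half_lt_self (lam_pos l))
    rw [h1, ← h2, h3]
  refine ⟨⟨f, fun ε hε => ?_⟩, ?_⟩
  · refine ((s (N (ε / 2) (half_pos hε))).support ε hε).subset ?_
    rintro l ⟨h1, h2⟩
    refine ⟨h1, ?_⟩
    rwa [hf (ε / 2) (half_pos hε) _ le_rfl l ((half_lt_self hε).trans_le h1)]
  · rw [Metric.tendsto_atTop]
    intro ε hε
    refine ⟨N (ε / 2) (half_pos hε), fun n hn => ?_⟩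
    refine lt_of_le_of_lt ?_ (half_lt_self hε)
    rw [dist_le_iff' _ _ (half_pos hε).le]
    exact fun l hl => hf _ _ n hn l hl

/-- Finitely supported functions as points of the model. -/
def ofFinsupp (f : Λ →₀ ℤ) : Model Λ where
  toFun := f
  support _ _ := f.support.finite_toSet.subset fun l h => by simpa using h.2

instance [Countable Λ] : TopologicalSpace.SeparableSpace (Model Λ) := by
  refine ⟨⟨Set.range ofFinsupp, Set.countable_range _, ?_⟩⟩
  intro ω
  rw [Metric.mem_closure_iff]
  intro ε hε
  have hfin := ω.support (ε / 2) (half_pos hε)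
  refine ⟨_, ⟨Finsupp.onFinset hfin.toFinset
    (fun l => if ε / 2 ≤ (l : ℝ) then ω.toFun l else 0) ?_, rfl⟩, ?_⟩
  · intro l hl
    by_cases h : ε / 2 ≤ (l : ℝ)
    · simpa [h] using hl
    · simp [h] at hl
  · refine lt_of_le_of_lt ?_ (half_lt_self hε)
    rw [dist_le_iff' _ _ (half_pos hε).le]
    intro l hl
    simp [ofFinsupp, hl.le]

open Classical in
/-- Change the value of `ω` at one point. -/
noncomputable def modify (ω : Model Λ) (l : Λ) (n : ℤ) : Model Λ where
  toFun := Function.update ω.toFun l n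
  support ε hε := ((ω.support ε hε).union (Set.finite_singleton l)).subset (by
    rintro m ⟨h1, h2⟩
    by_cases h : m = l
    · exact Or.inr h
    · rw [Function.update_of_ne h] at h2
      exact Or.inl ⟨h1, h2⟩)

theorem modify_self (ω : Model Λ) (l : Λ) (n : ℤ) : (ω.modify l n).toFun l = n := by
  simp [modify]

theorem modify_ne (ω : Model Λ) {l m : Λ} (n : ℤ) (h : m ≠ l) :
    (ω.modify l n).toFun m = ω.toFun m := by
  simp [modify, h]

instance : Inhabited (Model Λ) := ⟨ofFinsupp 0⟩

theorem spectrum : {r : ℝ | ∃ x y : Model Λ, x ≠ y ∧ dist x y = r} = Λ := by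
  ext r
  constructor
  · rintro ⟨x, y, h, rfl⟩
    obtain ⟨l, h1, h2⟩ := exists_max x y h
    have : dist x y = l := mdist_eq x y l h1 h2
    rw [this]
    exact l.2
  · intro hr
    let x : Model Λ := default
    let y : Model Λ := x.modify ⟨r, hr⟩ 1
    have h1 : x.toFun ⟨r, hr⟩ ≠ y.toFun ⟨r, hr⟩ := by
      rw [modify_self]
      change (0 : ℤ) ≠ 1
      norm_num
    refine ⟨x, y, fun h => h1 (by rw [← h]), ?_⟩
    exact dist_eq_of x y ⟨r, hr⟩ h1 fun m hm => (modify_ne _ _ hm.ne').symm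

theorem exists_point {Y : Type*} [MetricSpace Y] [IsUltrametricDist Y] [Finite Y]
    (hY : ∀ x y : Y, x ≠ y → dist x y ∈ Λ) (S : Set Y) (f : Y → Model Λ)
    (hf : ∀ x ∈ S, ∀ y ∈ S, dist (f x) (f y) = dist x y) (y : Y) (hy : y ∉ S) :
    ∃ u : Model Λ, ∀ x ∈ S, dist u (f x) = dist y x := by
  rcases S.eq_empty_or_nonempty with rfl | hS
  · exact ⟨default, fun x hx => hx.elim⟩
  obtain ⟨s₀, hs₀, hmin⟩ := S.toFinite.exists_minimalFor (fun s => dist y s) S hS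
  have hmin' : ∀ s ∈ S, dist y s₀ ≤ dist y s := fun s hs => by
    rcases le_total (dist y s) (dist y s₀) with h | h
    · exact hmin hs h
    · exact h
  have hne : y ≠ s₀ := fun h => hy (h ▸ hs₀)
  let r : Λ := ⟨dist y s₀, hY _ _ hne⟩
  obtain ⟨n, hn⟩ := ((S.toFinite.image fun s => (f s).toFun r)).exists_notMem
  have hn' : ∀ s ∈ S, n ≠ (f s).toFun r := fun s hs h => hn ⟨s, hs, h.symm⟩
  refine ⟨(f s₀).modify r n, fun s hs => ?_⟩
  have hu : dist ((f s₀).modify r n) (f s₀) = dist y s₀ := by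
    refine dist_eq_of _ _ r ?_ fun m hm => modify_ne _ _ hm.ne'
    rw [modify_self]
    exact hn' s₀ hs₀
  rcases lt_or_ge (dist y s₀) (dist s₀ s) with h | h
  · rw [IsUltrametricDist.dist_eq_max_of_dist_ne_dist _ (f s₀) _ (by
      rw [hu, hf _ hs₀ _ hs]; exact h.ne),
      IsUltrametricDist.dist_eq_max_of_dist_ne_dist y s₀ s h.ne, hu, hf _ hs₀ _ hs]
  · have h1 : dist y s = dist y s₀ := by
      refine le_antisymm ?_ (hmin' s hs)
      exact (IsUltrametricDist.dist_triangle_max y s₀ s).trans (max_le le_rfl h)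
    rw [h1]
    refine dist_eq_of _ _ r ?_ fun m hm => ?_
    · rw [modify_self]
      exact hn' s hs
    · rw [modify_ne _ _ hm.ne']
      refine (dist_le_iff' (f s₀) (f s) dist_nonneg).1 ((hf _ hs₀ _ hs).le.trans h) m ?_
      exact hm

theorem extension (Y : Type) [MetricSpace Y] [IsUltrametricDist Y] [Finite Y]
    (hY : ∀ x y : Y, x ≠ y → dist x y ∈ Λ) (S : Set Y) (f : S → Model Λ) (hf : Isometry f) :
    ∃ F : Y → Model Λ, Isometry F ∧ ∀ s : S, F s = f s := by
  classical
  have key : ∀ T : Set Y, T.Finite → ∃ F : Y → Model Λ,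
      (∀ x ∈ S ∪ T, ∀ y ∈ S ∪ T, dist (F x) (F y) = dist x y) ∧ ∀ s : S, F s = f s := by
    intro T hT
    induction T, hT using Set.Finite.induction_on with
    | empty =>
      refine ⟨fun y => if h : y ∈ S then f ⟨y, h⟩ else default, ?_, fun s => by simp⟩
      intro x hx y hy
      rw [Set.union_empty] at hx hy
      simp only [hx, hy, dif_pos, hf.dist_eq]
      rfl
    | @insert a T _ _ ih =>
      obtain ⟨F, hF1, hF2⟩ := ih
      by_cases ha : a ∈ S ∪ T
      · refine ⟨F, ?_, hF2⟩
        rw [Set.union_insert, Set.insert_eq_of_mem ha]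
        exact hF1
      · obtain ⟨u, hu⟩ := exists_point hY (S ∪ T) F hF1 a ha
        have hne : ∀ x ∈ S ∪ T, x ≠ a := fun x hx h => ha (h ▸ hx)
        refine ⟨Function.update F a u, ?_, fun s => ?_⟩
        · rw [Set.union_insert]
          rintro x (rfl | hx) y (rfl | hy)
          · simp
          · rw [Function.update_self, Function.update_of_ne (hne y hy), hu y hy]
          · rw [Function.update_self, Function.update_of_ne (hne x hx), dist_comm, hu x hx,
              dist_comm]
          · rw [Function.update_of_ne (hne x hx), Function.update_of_ne (hne y hy), hF1 x hx y hy]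
        · rw [Function.update_of_ne (hne s (Or.inl s.2)), hF2]
  obtain ⟨F, hF1, hF2⟩ := key Set.univ Set.finite_univ
  exact ⟨F, Isometry.of_dist_eq fun x y => hF1 x (Or.inr trivial) y (Or.inr trivial), hF2⟩

/-- For countable `Λ ⊆ (0, ∞)`, the model is an Urysohn space with spectrum `Λ`. -/
instance isUrysohn [Countable Λ] : IsUrysohn Λ (Model Λ) where
  ultra := inferInstance
  complete := inferInstance
  separable := inferInstance
  spectrum := spectrum
  extension := extension

end Model

end UltraUrysohn

/-! ### Hilbert spaces -/

section HilbertSpaces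

/-- Two total families of vectors with the same Gram matrix are unitarily equivalent. -/
theorem exists_unitary_of_gram {ι H H' : Type*} [NormedAddCommGroup H] [InnerProductSpace ℂ H]
    [CompleteSpace H] [NormedAddCommGroup H'] [InnerProductSpace ℂ H'] [CompleteSpace H']
    (f : ι → H) (f' : ι → H') (hf : Dense (Submodule.span ℂ (Set.range f) : Set H))
    (hf' : Dense (Submodule.span ℂ (Set.range f') : Set H'))
    (h : ∀ i j, inner ℂ (f i) (f j) = inner ℂ (f' i) (f' j)) :
    ∃ V : H ≃ₗᵢ[ℂ] H', ∀ i, V (f i) = f' i := by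
  have d : DenseRange (Finsupp.linearCombination ℂ f) := by
    rw [DenseRange, ← LinearMap.coe_range, Finsupp.range_linearCombination]
    exact hf
  have d' : DenseRange (Finsupp.linearCombination ℂ f') := by
    rw [DenseRange, ← LinearMap.coe_range, Finsupp.range_linearCombination]
    exact hf'
  have hn : ∀ x, ‖Finsupp.linearCombination ℂ f' (LinearEquiv.refl ℂ _ x)‖ =
      ‖Finsupp.linearCombination ℂ f x‖ := by
    intro x
    have : inner ℂ (Finsupp.linearCombination ℂ f' x) (Finsupp.linearCombination ℂ f' x) =
        inner ℂ (Finsupp.linearCombination ℂ f x) (Finsupp.linearCombination ℂ f x) := by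
      simp only [Finsupp.linearCombination_apply, Finsupp.sum, sum_inner, inner_sum,
        inner_smul_left, inner_smul_right, h]
    rw [LinearEquiv.refl_apply, norm_eq_sqrt_re_inner (𝕜 := ℂ), this,
      ← norm_eq_sqrt_re_inner (𝕜 := ℂ)]
  refine ⟨(LinearEquiv.refl ℂ (ι →₀ ℂ)).extendOfIsometry _ _ d d' hn, fun i => ?_⟩
  have := LinearEquiv.extendOfIsometry_eq (LinearEquiv.refl ℂ (ι →₀ ℂ)) _ _ d d' hn
    (Finsupp.single i 1)
  simpa using this

/-- A positive definite kernel is the Gram matrix of a total family in a Hilbert space. -/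
theorem exists_family_of_kernel {ι : Type u} (K : ι → ι → ℂ)
    (hK : ∀ i j, (starRingEnd ℂ) (K i j) = K j i)
    (hpos : ∀ c : ι →₀ ℂ, 0 ≤ (c.sum fun i a => c.sum fun j b =>
      (starRingEnd ℂ) a * b * K i j).re) :
    ∃ (H : Type u) (_ : NormedAddCommGroup H) (_ : InnerProductSpace ℂ H) (_ : CompleteSpace H)
      (f : ι → H), Dense (Submodule.span ℂ (Set.range f) : Set H) ∧
      ∀ i j, inner ℂ (f i) (f j) = K i j := by
  let M : Matrix ι ι (ℂ →L[ℂ] ℂ) := .of fun i j => K i j • ContinuousLinearMap.id ℂ ℂ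
  have hM : M.PosSemidef := by
    have hM' : M.IsHermitian ∧ ∀ c : ι →₀ ℂ,
        0 ≤ RCLike.re (c.sum fun x w => c.sum fun x' w' => inner ℂ (M x' x w) w') := by
      refine ⟨?_, fun c => ?_⟩
      · ext i j
        simp [M, Matrix.conjTranspose_apply, star_smul, hK, ContinuousLinearMap.star_eq_adjoint,
          ContinuousLinearMap.adjoint_id]
      · refine (hpos c).trans_eq ?_
        simp only [Finsupp.sum]
        congr! 3
        simp [M, hK]
        ring
    exact (RKHS.posSemidef_tfae.out 0 2).2 hM'
  have : Fact M.PosSemidef := ⟨hM⟩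
  refine ⟨RKHS.OfKernel M, inferInstance, inferInstance, inferInstance,
    fun i => RKHS.kerFun (RKHS.OfKernel M) i 1, ?_, fun i j => ?_⟩
  · rw [Submodule.dense_iff_topologicalClosure_eq_top, ← top_le_iff,
      ← RKHS.kerFun_dense (RKHS.OfKernel M)]
    refine Submodule.topologicalClosure_mono (Submodule.span_le.2 ?_)
    rintro _ ⟨i, z, rfl⟩
    have : RKHS.kerFun (RKHS.OfKernel M) i z = z • RKHS.kerFun (RKHS.OfKernel M) i 1 := by
      rw [← map_smul, smul_eq_mul, mul_one]
    rw [this]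
    exact Submodule.smul_mem _ _ (Submodule.subset_span ⟨i, rfl⟩)
  · rw [← RKHS.kernel_inner, RKHS.OfKernel.kernel_ofKernel]
    simp [M, hK]

/-- A separable Hilbert space has a unitary copy in each universe. -/
theorem exists_hilb_equiv (E : Type*) [NormedAddCommGroup E] [InnerProductSpace ℂ E]
    [CompleteSpace E] [TopologicalSpace.SeparableSpace E] :
    ∃ H : UltraUrysohn.Hilb.{v}, Nonempty (E ≃ₗᵢ[ℂ] H) := by
  obtain ⟨w, b, hb⟩ := exists_hilbertBasis ℂ E
  have hw : Countable w := by
    refine (Set.PairwiseDisjoint.countable_of_isOpen (s := fun x : E => Metric.ball x (1 / 2))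
      (a := w) ?_ (fun _ _ => Metric.isOpen_ball) fun x _ => ⟨x, by simp⟩).to_subtype
    intro x hx y hy hxy
    refine Metric.ball_disjoint_ball ?_
    have hx1 : ‖x‖ = 1 := by simpa [hb] using b.orthonormal.1 ⟨x, hx⟩
    have hxy0 : inner ℂ x y = 0 := by
      simpa [hb] using b.orthonormal.2 (i := ⟨x, hx⟩) (j := ⟨y, hy⟩) (by simpa using hxy)
    have h1 : inner ℂ x (x - y) = 1 := by
      rw [inner_sub_right, hxy0, inner_self_eq_norm_sq_to_K, hx1]
      simp
    have h2 := norm_inner_le_norm (𝕜 := ℂ) x (x - y)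
    rw [h1, hx1, norm_one, one_mul] at h2
    rw [dist_eq_norm]
    linarith
  obtain ⟨t, ⟨φ⟩⟩ : ∃ t : Set ℕ, Nonempty (w ≃ t) := by
    obtain ⟨φ, hφ⟩ := hw.exists_injective_nat
    exact ⟨_, ⟨Equiv.ofInjective φ hφ⟩⟩
  let ψ : ULift.{v} t ≃ w := Equiv.ulift.trans φ.symm
  let b' : HilbertBasis (ULift.{v} t) ℂ E := HilbertBasis.mk (v := b ∘ ψ)
    (b.orthonormal.comp _ ψ.injective) (by
      rw [ψ.surjective.range_comp, b.dense_span])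
  have : TopologicalSpace.SeparableSpace (lp (fun _ : ULift.{v} t => ℂ) 2) :=
    b'.repr.surjective.denseRange.separableSpace b'.repr.continuous
  exact ⟨⟨lp (fun _ : ULift.{v} t => ℂ) 2⟩, ⟨b'.repr⟩⟩

/-- For a group of unitary operators, the projection of `ξ` to the space of invariant vectors lies
in the closed convex hull of the orbit of `ξ`. -/
theorem exists_invariant_mem_closure {G H : Type*} [Group G] [NormedAddCommGroup H]
    [InnerProductSpace ℂ H] [CompleteSpace H] (ρ : G →* (H ≃ₗᵢ[ℂ] H)) (Γ : Subgroup G) (ξ : H) :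
    ∃ m ∈ closure (convexHull ℝ ((fun g => ρ g ξ) '' Γ)), ∀ g ∈ Γ, ρ g m = m := by
  let _ : InnerProductSpace ℝ H := InnerProductSpace.rclikeToReal ℂ H
  set C := closure (convexHull ℝ ((fun g => ρ g ξ) '' (Γ : Set G))) with hC
  have hconv : Convex ℝ C := (convex_convexHull ℝ _).closure
  have hne : C.Nonempty := ⟨_, subset_closure (subset_convexHull ℝ _ ⟨1, Γ.one_mem, rfl⟩)⟩
  obtain ⟨m, hm, hmin⟩ := exists_norm_eq_iInf_of_complete_convex hne
    (isClosed_closure.isComplete) hconv 0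
  refine ⟨m, hm, fun g hg => ?_⟩
  have hgm : ρ g m ∈ C := by
    refine map_mem_closure (ρ g).continuous hm fun x hx => ?_
    have hx' := Set.mem_image_of_mem ((ρ g).toLinearEquiv.toLinearMap.restrictScalars ℝ) hx
    rw [LinearMap.image_convexHull] at hx'
    refine convexHull_mono ?_ hx'
    rintro _ ⟨_, ⟨k, hk, rfl⟩, rfl⟩
    exact ⟨g * k, Γ.mul_mem hg hk, by simp⟩
  have h1 := (norm_eq_iInf_iff_real_inner_le_zero hconv hm).1 hmin _ hgm
  have hmin' : ‖0 - ρ g m‖ = ⨅ w : C, ‖(0 : H) - w‖ := by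
    rw [← hmin, zero_sub, zero_sub, norm_neg, norm_neg, LinearIsometryEquiv.norm_map]
  have h2 := (norm_eq_iInf_iff_real_inner_le_zero hconv hgm).1 hmin' _ hm
  rw [← sub_eq_zero, ← norm_eq_zero, ← sq_eq_zero_iff]
  refine le_antisymm ?_ (sq_nonneg _)
  rw [← real_inner_self_eq_norm_sq]
  have : inner ℝ (ρ g m - m) (ρ g m - m) =
    inner ℝ (0 - m) (ρ g m - m) + inner ℝ (0 - ρ g m) (m - ρ g m) := by
    simp only [inner_sub_left, inner_sub_right, inner_zero_left]
    ring
  rw [this]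
  exact add_nonpos h1 h2

end HilbertSpaces

namespace UltraUrysohn

open CategoryTheory

section Homogeneity

theorem IsUrysohn.nonempty (Λ : Set ℝ) {U : Type u} [MetricSpace U] [IsUrysohn Λ U] :
    Nonempty U := by
  have : IsUltrametricDist PUnit.{u + 1} := ⟨fun x y z => by simp⟩
  obtain ⟨F, -⟩ := IsUrysohn.extension (Λ := Λ) (U := U) PUnit
    (fun x y h => (h (Subsingleton.elim x y)).elim) ∅
    (fun s => s.2.elim) (fun s => s.2.elim)
  exact ⟨F PUnit.unit⟩

/-- One-point extension of finite partial isometries of an Urysohn space. -/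
theorem IsUrysohn.exists_insert (Λ : Set ℝ) {U : Type u} [MetricSpace U] [IsUrysohn Λ U]
    (R : Set (U × U)) (hR : R.Finite)
    (hiso : ∀ p ∈ R, ∀ q ∈ R, dist p.1 q.1 = dist p.2 q.2) (x : U) :
    ∃ y, ∀ p ∈ insert (x, y) R, ∀ q ∈ insert (x, y) R, dist p.1 q.1 = dist p.2 q.2 := by
  have : IsUltrametricDist U := IsUrysohn.ultra Λ
  let Y : Set U := insert x (Prod.fst '' R)
  have : Finite Y := ((hR.image _).insert x).to_subtype
  let S : Set Y := {a | a.1 ∈ Prod.fst '' R}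
  have hS : ∀ s : S, ∃ p ∈ R, p.1 = s.1.1 := fun s => s.2
  choose f hf1 hf2 using hS
  obtain ⟨F, hF, hFf⟩ := IsUrysohn.extension (Λ := Λ) (U := U) Y
    (fun a b h => IsUrysohn.dist_mem (U := U) (x := a.1) (y := b.1) fun h' => h (Subtype.ext h'))
    S (fun s => (f s).2) (Isometry.of_dist_eq fun s t => by
      rw [← hiso _ (hf1 s) _ (hf1 t), hf2, hf2]
      rfl)
  have hval : ∀ p (hp : p ∈ R), F ⟨p.1, Or.inr ⟨p, hp, rfl⟩⟩ = p.2 := by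
    intro p hp
    rw [hFf ⟨⟨p.1, Or.inr ⟨p, hp, rfl⟩⟩, ⟨p, hp, rfl⟩⟩, ← dist_eq_zero,
      ← hiso _ (hf1 _) _ hp, hf2, dist_self]
  refine ⟨F ⟨x, Or.inl rfl⟩, ?_⟩
  have key : ∀ p ∈ insert (x, F ⟨x, Or.inl rfl⟩) R, ∃ a : Y, p = (a.1, F a) := by
    rintro p (rfl | hp)
    · exact ⟨⟨x, Or.inl rfl⟩, rfl⟩
    · exact ⟨⟨p.1, Or.inr ⟨p, hp, rfl⟩⟩, Prod.ext rfl (hval p hp).symm⟩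
  intro p hp q hq
  obtain ⟨a, rfl⟩ := key p hp
  obtain ⟨b, rfl⟩ := key q hq
  exact (hF.dist_eq a b).symm

/-- Finite partial isometries of an Urysohn space extend to isometries. -/
theorem IsUrysohn.exists_extend (Λ : Set ℝ) {U : Type u} [MetricSpace U] [IsUrysohn Λ U]
    (R : Set (U × U)) (hR : R.Finite)
    (hiso : ∀ p ∈ R, ∀ q ∈ R, dist p.1 q.1 = dist p.2 q.2) :
    ∃ g : U ≃ᵢ U, ∀ p ∈ R, g p.1 = p.2 := by
  have : CompleteSpace U := IsUrysohn.complete Λ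
  have : TopologicalSpace.SeparableSpace U := IsUrysohn.separable Λ
  let D : Type u := {R : Set (U × U) // R.Finite ∧
    ∀ p ∈ R, ∀ q ∈ R, dist p.1 q.1 = dist p.2 q.2}
  have step : ∀ (R : D) (x : U), ∃ R' : D, R.1 ⊆ R'.1 ∧ x ∈ Prod.fst '' R'.1 ∧
      x ∈ Prod.snd '' R'.1 := by
    intro R x
    obtain ⟨y, hy⟩ := IsUrysohn.exists_insert Λ R.1 R.2.1 R.2.2 x
    obtain ⟨z, hz⟩ := IsUrysohn.exists_insert Λ (Prod.swap '' insert (x, y) R.1)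
      ((R.2.1.insert _).image _) (by
        rintro _ ⟨p, hp, rfl⟩ _ ⟨q, hq, rfl⟩
        exact (hy p hp q hq).symm) x
    refine ⟨⟨insert (z, x) (insert (x, y) R.1), (R.2.1.insert _).insert _, ?_⟩, ?_, ?_, ?_⟩
    · have : ∀ p ∈ insert (z, x) (insert (x, y) R.1),
          p.swap ∈ insert (x, z) (Prod.swap '' insert (x, y) R.1) := by
        rintro p (rfl | hp)
        · exact Or.inl rfl
        · exact Or.inr ⟨p, hp, rfl⟩
      intro p hp q hq
      exact (hz _ (this p hp) _ (this q hq)).symm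
    · exact (Set.subset_insert _ _).trans (Set.subset_insert _ _)
    · exact ⟨_, Or.inr (Or.inl rfl), rfl⟩
    · exact ⟨_, Or.inl rfl, rfl⟩
  choose next hnext1 hnext2 hnext3 using step
  have : Nonempty U := IsUrysohn.nonempty Λ
  let d := TopologicalSpace.denseSeq U
  let s : ℕ → D := fun n => Nat.rec ⟨R, hR, hiso⟩ (fun n S => next S (d n)) n
  have hs : ∀ n, s (n + 1) = next (s n) (d n) := fun _ => rfl
  have hmono : Monotone fun n => (s n).1 := monotone_nat_of_le_succ fun n => hnext1 _ _
  let T : Set (U × U) := ⋃ n, (s n).1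
  have hT : ∀ p ∈ T, ∀ q ∈ T, dist p.1 q.1 = dist p.2 q.2 := by
    intro p hp q hq
    obtain ⟨m, hm⟩ := Set.mem_iUnion.1 hp
    obtain ⟨n, hn⟩ := Set.mem_iUnion.1 hq
    exact (s (max m n)).2.2 p (hmono (le_max_left m n) hm) q (hmono (le_max_right m n) hn)
  let C := closure T
  have hC : ∀ p ∈ C, ∀ q ∈ C, dist p.1 q.1 = dist p.2 q.2 := by
    have hcl : IsClosed {z : (U × U) × (U × U) | dist z.1.1 z.2.1 = dist z.1.2 z.2.2} :=
      isClosed_eq (by fun_prop) (by fun_prop)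
    intro p hp q hq
    have hpq : (p, q) ∈ closure (T ×ˢ T) := by
      rw [closure_prod_eq]
      exact ⟨hp, hq⟩
    exact closure_minimal (fun z hz => hT _ hz.1 _ hz.2) hcl hpq
  have : CompleteSpace C := isClosed_closure.completeSpace_coe
  have h1 : Isometry fun p : C => p.1.1 := Isometry.of_dist_eq fun p q => by
    rw [Subtype.dist_eq, Prod.dist_eq, ← hC p.1 p.2 q.1 q.2, max_self]
  have h2 : Isometry fun p : C => p.1.2 := Isometry.of_dist_eq fun p q => by
    rw [Subtype.dist_eq, Prod.dist_eq, hC p.1 p.2 q.1 q.2, max_self]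
  have surj : ∀ f : C → U, Isometry f → (∀ n, d n ∈ Set.range f) → Function.Surjective f := by
    intro f hf hd
    rw [← Set.range_eq_univ, ← hf.isClosedEmbedding.isClosed_range.closure_eq]
    refine ((TopologicalSpace.denseRange_denseSeq U).mono ?_).closure_eq
    rintro _ ⟨n, rfl⟩
    exact hd n
  have hsub : ∀ n, (s n).1 ⊆ C := fun n =>
    (Set.subset_iUnion (fun n => (s n).1) n).trans subset_closure
  have s1 := surj _ h1 fun n => by
    obtain ⟨p, hp, h⟩ := hnext2 (s n) (d n)
    exact ⟨⟨p, hsub (n + 1) hp⟩, h⟩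
  have s2 := surj _ h2 fun n => by
    obtain ⟨p, hp, h⟩ := hnext3 (s n) (d n)
    exact ⟨⟨p, hsub (n + 1) hp⟩, h⟩
  let e1 : C ≃ᵢ U := ⟨Equiv.ofBijective _ ⟨h1.injective, s1⟩, h1⟩
  let e2 : C ≃ᵢ U := ⟨Equiv.ofBijective _ ⟨h2.injective, s2⟩, h2⟩
  refine ⟨e1.symm.trans e2, fun p hp => ?_⟩
  have : e1.symm p.1 = ⟨p, hsub 0 hp⟩ := by
    rw [IsometryEquiv.symm_apply_eq]
    rfl
  rw [IsometryEquiv.trans_apply, this]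
  rfl

theorem IsUrysohn.exists_isometry (Λ : Set ℝ) {U : Type u} [MetricSpace U] [IsUrysohn Λ U]
    {X : Type*} [Finite X] [MetricSpace X] (a b : X → U)
    (ha : Isometry a) (hb : Isometry b) : ∃ g : U ≃ᵢ U, ∀ x, g (a x) = b x := by
  obtain ⟨g, hg⟩ := IsUrysohn.exists_extend Λ (Set.range fun x => (a x, b x))
    (Set.finite_range _) (by
      rintro _ ⟨x, rfl⟩ _ ⟨y, rfl⟩
      rw [ha.dist_eq, hb.dist_eq])
  exact ⟨g, fun x => hg _ ⟨x, rfl⟩⟩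

end Homogeneity

section Morphisms

variable {Λ : Set ℝ}

/-- The cross distances of a morphism. -/
def cross {X Y : KObj.{u} Λ} (p : X ⟶ Y) : X → Y → ℝ :=
  Quotient.lift (s := Triple.setoid X Y) Triple.cross
    (fun p q h => funext fun x => funext fun y => (Triple.same_iff_cross p q).1 h x y) p

theorem mor_ext {X Y : KObj.{u} Λ} {p q : X ⟶ Y} (h : ∀ x y, cross p x y = cross q x y) :
    p = q := by
  induction p using Quotient.inductionOn with | _ p
  induction q using Quotient.inductionOn with | _ q
  exact Quotient.sound ((Triple.same_iff_cross p q).2 h)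

theorem cross_comp {X Y Z : KObj.{u} Λ} (p : X ⟶ Y) (q : Y ⟶ Z) (x : X) (z : Z) :
    cross (p ≫ q) x z = ⨅ y, max (cross p x y) (cross q y z) := by
  induction p using Quotient.inductionOn with | _ p
  induction q using Quotient.inductionOn with | _ q
  rfl

theorem cross_comp_eq {X Y Z : KObj.{u} Λ} {p : X ⟶ Y} {q : Y ⟶ Z} {x : X} {z : Z} {r : ℝ}
    (hle : ∀ y, r ≤ max (cross p x y) (cross q y z))
    (hex : ∃ y, max (cross p x y) (cross q y z) = r) : cross (p ≫ q) x z = r := by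
  rw [cross_comp]
  obtain ⟨y, hy⟩ := hex
  exact le_antisymm ((ciInf_le (Set.finite_range _).bddBelow y).trans hy.le) (le_ciInf hle)

theorem cross_morStar {X Y : KObj.{u} Λ} (p : X ⟶ Y) (x : X) (y : Y) :
    cross (morStar p) y x = cross p x y := by
  induction p using Quotient.inductionOn with | _ p
  exact dist_comm _ _

end Morphisms

section Embeddings

variable {Λ : Set ℝ} {U : Type u} [MetricSpace U]

/-- The translate of an embedding by an isometry. -/
def IsoEmb.translate {X : KObj.{u} Λ} (g : U ≃ᵢ U) (a : IsoEmb X U) : IsoEmb X U :=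
  ⟨fun x => g (a.toFun x), g.isometry.comp a.isometry⟩

theorem IsoEmb.translate_mul {X : KObj.{u} Λ} (g h : U ≃ᵢ U) (a : IsoEmb X U) :
    a.translate (g * h) = (a.translate h).translate g := rfl

theorem IsoEmb.translate_one {X : KObj.{u} Λ} (a : IsoEmb X U) : a.translate 1 = a := rfl

theorem IsoEmb.ext {X : KObj.{u} Λ} {a b : IsoEmb X U} (h : ∀ x, a.toFun x = b.toFun x) :
    a = b := by
  cases a
  cases b
  congr
  exact funext h

variable [IsUrysohn Λ U]

theorem cross_isometryMor {X Y : KObj.{u} Λ} (a : IsoEmb X U) (b : IsoEmb Y U) (g : U ≃ᵢ U)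
    (x : X) (y : Y) : cross (isometryMor a b g) x y = dist (g (a.toFun x)) (b.toFun y) := rfl

/-- The morphism given by the relative position of two embedded spaces. -/
def embMor {X Y : KObj.{u} Λ} (a : IsoEmb X U) (b : IsoEmb Y U) : X ⟶ Y := isometryMor a b 1

theorem cross_embMor {X Y : KObj.{u} Λ} (a : IsoEmb X U) (b : IsoEmb Y U) (x : X) (y : Y) :
    cross (embMor a b) x y = dist (a.toFun x) (b.toFun y) := rfl

theorem isometryMor_eq_embMor {X Y : KObj.{u} Λ} (a : IsoEmb X U) (b : IsoEmb Y U) (g : U ≃ᵢ U) :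
    isometryMor a b g = embMor (a.translate g) b := rfl

theorem embMor_translate {X Y : KObj.{u} Λ} (a : IsoEmb X U) (b : IsoEmb Y U) (g : U ≃ᵢ U) :
    embMor (a.translate g) (b.translate g) = embMor a b :=
  mor_ext fun _ _ => g.dist_eq _ _

theorem embMor_translate_left {X Y : KObj.{u} Λ} (a : IsoEmb X U) (b : IsoEmb Y U) (g : U ≃ᵢ U) :
    embMor (a.translate g) b = embMor a (b.translate g⁻¹) := by
  rw [← embMor_translate a (b.translate g⁻¹) g, ← IsoEmb.translate_mul, mul_inv_cancel,
    IsoEmb.translate_one]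

theorem embMor_self {X : KObj.{u} Λ} (a : IsoEmb X U) : embMor a a = 𝟙 X :=
  mor_ext fun _ _ => a.isometry.dist_eq _ _

theorem morStar_embMor {X Y : KObj.{u} Λ} (a : IsoEmb X U) (b : IsoEmb Y U) :
    morStar (embMor a b) = embMor b a :=
  mor_ext fun y x => by rw [cross_morStar, cross_embMor, cross_embMor, dist_comm]

/-- Composition through an embedded space containing the source. -/
theorem embMor_comp_of_left {X Y Z : KObj.{u} Λ} (a : IsoEmb X U) (b : IsoEmb Y U)
    (c : IsoEmb Z U) (h : Set.range a.toFun ⊆ Set.range b.toFun) :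
    embMor a b ≫ embMor b c = embMor a c := by
  have : IsUltrametricDist U := IsUrysohn.ultra Λ
  refine mor_ext fun x z => cross_comp_eq (fun y =>
    IsUltrametricDist.dist_triangle_max (a.toFun x) (b.toFun y) (c.toFun z)) ?_
  obtain ⟨y, hy⟩ := h ⟨x, rfl⟩
  exact ⟨y, by rw [cross_embMor, cross_embMor, cross_embMor, hy, dist_self,
    max_eq_right dist_nonneg]⟩

/-- Composition through an embedded space containing the target. -/
theorem embMor_comp_of_right {X Y Z : KObj.{u} Λ} (a : IsoEmb X U) (b : IsoEmb Y U)
    (c : IsoEmb Z U) (h : Set.range c.toFun ⊆ Set.range b.toFun) :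
    embMor a b ≫ embMor b c = embMor a c := by
  have : IsUltrametricDist U := IsUrysohn.ultra Λ
  refine mor_ext fun x z => cross_comp_eq (fun y =>
    IsUltrametricDist.dist_triangle_max (a.toFun x) (b.toFun y) (c.toFun z)) ?_
  obtain ⟨y, hy⟩ := h ⟨z, rfl⟩
  exact ⟨y, by rw [cross_embMor, cross_embMor, cross_embMor, hy, dist_self,
    max_eq_left dist_nonneg]⟩

theorem IsoEmb.exists_translate_eq {X : KObj.{u} Λ} (a b : IsoEmb X U) :
    ∃ g : U ≃ᵢ U, a.translate g = b := by
  obtain ⟨g, hg⟩ := IsUrysohn.exists_isometry Λ a.toFun b.toFun a.isometry b.isometry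
  exact ⟨g, IsoEmb.ext hg⟩

/-- Each morphism is the relative position of an embedded space to a given embedding of its
target. -/
theorem exists_embMor_eq {X Y : KObj.{u} Λ} (b : IsoEmb Y U) (p : X ⟶ Y) :
    ∃ a : IsoEmb X U, embMor a b = p := by
  induction p using Quotient.inductionOn with | _ p
  obtain ⟨c⟩ := IsUrysohn.nonempty_isoEmb (U := U) p.P
  obtain ⟨g, hg⟩ := IsoEmb.exists_translate_eq
    ⟨fun y => c.toFun (p.minus y), c.isometry.comp p.isometry_minus⟩ b
  refine ⟨⟨fun x => g (c.toFun (p.plus x)),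
    g.isometry.comp (c.isometry.comp p.isometry_plus)⟩, mor_ext fun x y => ?_⟩
  rw [cross_embMor, ← hg]
  exact (g.dist_eq _ _).trans (c.isometry.dist_eq _ _)

theorem exists_isometryMor_eq {X Y : KObj.{u} Λ} (a : IsoEmb X U) (b : IsoEmb Y U) (p : X ⟶ Y) :
    ∃ g : U ≃ᵢ U, isometryMor a b g = p := by
  obtain ⟨a', ha'⟩ := exists_embMor_eq b p
  obtain ⟨g, hg⟩ := a.exists_translate_eq a'
  exact ⟨g, by rw [isometryMor_eq_embMor, hg, ha']⟩

/-- Embedded spaces with the same position relative to `b` differ by an isometry fixing `b`. -/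
theorem exists_translate_of_embMor_eq {X Y : KObj.{u} Λ} (a a' : IsoEmb X U) (b : IsoEmb Y U)
    (h : embMor a b = embMor a' b) :
    ∃ g : U ≃ᵢ U, a.translate g = a' ∧ ∀ u ∈ Set.range b.toFun, g u = u := by
  have hc : ∀ x y, dist (a.toFun x) (b.toFun y) = dist (a'.toFun x) (b.toFun y) := fun x y => by
    rw [← cross_embMor, h, cross_embMor]
  obtain ⟨g, hg⟩ := IsUrysohn.exists_extend Λ
    (Set.range (fun x => (a.toFun x, a'.toFun x)) ∪ Set.range fun y => (b.toFun y, b.toFun y))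
    ((Set.finite_range _).union (Set.finite_range _)) (by
      rintro _ (⟨x, rfl⟩ | ⟨x, rfl⟩) _ (⟨y, rfl⟩ | ⟨y, rfl⟩)
      · rw [a.isometry.dist_eq, a'.isometry.dist_eq]
      · exact hc x y
      · rw [dist_comm, hc, dist_comm]
      · rfl)
  refine ⟨g, IsoEmb.ext fun x => hg _ (Or.inl ⟨x, rfl⟩), ?_⟩
  rintro _ ⟨y, rfl⟩
  exact hg _ (Or.inr ⟨y, rfl⟩)

/-- The object given by a nonempty finite subset of the Urysohn space. -/
def subsetObj (S : Set U) (hS : S.Finite) (hne : S.Nonempty) : KObj.{u} Λ :=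
  have : IsUltrametricDist U := IsUrysohn.ultra Λ
  have : Finite S := hS.to_subtype
  have : Nonempty S := hne.to_subtype
  { carrier := S
    spectrum := fun x y h =>
      IsUrysohn.dist_mem (U := U) (x := x.1) (y := y.1) fun h' => h (Subtype.ext h') }

/-- The inclusion of a nonempty finite subset of the Urysohn space. -/
def subsetEmb (S : Set U) (hS : S.Finite) (hne : S.Nonempty) :
    IsoEmb (subsetObj (Λ := Λ) S hS hne) U :=
  ⟨Subtype.val, isometry_subtype_coe⟩

theorem range_subsetEmb (S : Set U) (hS : S.Finite) (hne : S.Nonempty) :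
    Set.range (subsetEmb (Λ := Λ) S hS hne).toFun = S := Subtype.range_val

/-- A finite embedded space can be moved by an isometry fixing `b` to a position independent of `c`
over `b`. -/
theorem exists_translate_embMor_comp {X Y Z : KObj.{u} Λ} (a : IsoEmb X U) (b : IsoEmb Y U)
    (c : IsoEmb Z U) : ∃ g : U ≃ᵢ U, (∀ u ∈ Set.range b.toFun, g u = u) ∧
      embMor (a.translate g) c = embMor a b ≫ embMor b c := by
  let S := Set.range b.toFun ∪ Set.range c.toFun
  let d : IsoEmb (subsetObj (Λ := Λ) S ((Set.finite_range _).union (Set.finite_range _))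
    (Set.range_nonempty _).inl) U := subsetEmb S _ _
  have hb : Set.range b.toFun ⊆ Set.range d.toFun := by
    rw [range_subsetEmb]
    exact Set.subset_union_left
  have hc : Set.range c.toFun ⊆ Set.range d.toFun := by
    rw [range_subsetEmb]
    exact Set.subset_union_right
  obtain ⟨a', ha'⟩ := exists_embMor_eq d (embMor a b ≫ embMor b d)
  obtain ⟨g, rfl, hg⟩ := exists_translate_of_embMor_eq a a' b (by
    rw [← embMor_comp_of_right a' d b hb, ha', Category.assoc, embMor_comp_of_left b d b hb,
      embMor_self, Category.comp_id])
  refine ⟨g, hg, ?_⟩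
  rw [← embMor_comp_of_right _ d c hc, ha', Category.assoc, embMor_comp_of_left b d c hb]

end Embeddings

section IsometryGroup

variable {U : Type u} [MetricSpace U]

/-- The pointwise stabilizer of a set. -/
def stabilizer (S : Set U) : Subgroup (U ≃ᵢ U) where
  carrier := {g | ∀ s ∈ S, g s = s}
  one_mem' _ _ := rfl
  mul_mem' {g h} hg hh s hs := by
    rw [IsometryEquiv.mul_apply, hh s hs, hg s hs]
  inv_mem' {g} hg s hs := by
    change g.symm s = s
    rw [IsometryEquiv.symm_apply_eq, hg s hs]

theorem continuous_eval_isometry (x : U) : Continuous fun g : U ≃ᵢ U => g x :=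
  (continuous_apply x).comp continuous_induced_dom

theorem continuous_mul_isometry (s t : U ≃ᵢ U) : Continuous fun g : U ≃ᵢ U => s * g * t :=
  continuous_induced_rng.2 <| continuous_pi fun x =>
    s.continuous.comp (continuous_eval_isometry (t x))

theorem exists_finite_of_mem_nhds_one {V : Set (U ≃ᵢ U)} (hV : V ∈ nhds 1) :
    ∃ F : Set U, F.Finite ∧ ∃ ε > 0, ∀ g : U ≃ᵢ U, (∀ x ∈ F, dist (g x) x < ε) → g ∈ V := by
  rw [nhds_induced, Filter.mem_comap] at hV
  obtain ⟨W, hW, hWV⟩ := hV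
  rw [nhds_pi, Filter.mem_pi] at hW
  obtain ⟨F, hF, t, ht, htW⟩ := hW
  have : ∀ x, ∃ ε > 0, Metric.ball x ε ⊆ t x := fun x => Metric.mem_nhds_iff.1 (ht x)
  choose ε hε hεt using this
  obtain ⟨δ, hδ, hδε⟩ : ∃ δ > 0, ∀ x ∈ F, δ ≤ ε x := by
    have h1 : ∀ᶠ δ : ℝ in nhdsWithin 0 (Set.Ioi 0), ∀ x ∈ F, δ ≤ ε x :=
      (Filter.eventually_all_finite hF).2 fun x _ =>
        Filter.mem_of_superset (Ioc_mem_nhdsGT (hε x)) fun δ hδ => hδ.2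
    exact ((eventually_mem_nhdsWithin (a := (0 : ℝ))).and h1).exists
  exact ⟨F, hF, δ, hδ, fun g hg => hWV (htW fun x hx =>
    hεt x (Metric.mem_ball.2 ((hg x hx).trans_le (hδε x hx))))⟩

end IsometryGroup

section Convexity

theorem inner_eq_of_mem_convexHull {H : Type*} [NormedAddCommGroup H] [InnerProductSpace ℂ H]
    {A : Set H} {η : H} {c : ℂ} (h : ∀ x ∈ A, inner ℂ η x = c) {x : H}
    (hx : x ∈ convexHull ℝ A) : inner ℂ η x = c :=
  convexHull_min (s := A) h ((convex_singleton c).linear_preimage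
    ((innerSL ℂ η).toLinearMap.restrictScalars ℝ)) hx

theorem inner_eq_of_mem_closure_convexHull {H : Type*} [NormedAddCommGroup H]
    [InnerProductSpace ℂ H] {A : Set H} {η : H} {c : ℂ} (h : ∀ x ∈ A, inner ℂ η x = c) {x : H}
    (hx : x ∈ closure (convexHull ℝ A)) : inner ℂ η x = c :=
  closure_minimal (s := convexHull ℝ A) (fun _ => inner_eq_of_mem_convexHull h)
    (isClosed_eq (by fun_prop) continuous_const) hx

end Convexity

namespace UnitaryRep

variable {U : Type u} [MetricSpace U] (ρ : UnitaryRep.{u, v} U)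

theorem hom_mul_apply (g h : U ≃ᵢ U) (ξ : ρ.space) :
    ρ.hom (g * h) ξ = ρ.hom g (ρ.hom h ξ) := by
  rw [map_mul]
  rfl

theorem inner_hom_left (g : U ≃ᵢ U) (ξ η : ρ.space) :
    inner ℂ (ρ.hom g ξ) η = inner ℂ ξ (ρ.hom g⁻¹ η) := by
  rw [← (ρ.hom g⁻¹).inner_map_map, ← hom_mul_apply, inv_mul_cancel,
    map_one]
  rfl

theorem starProjection_mem_closure (S : Set U) (ξ : ρ.space) :
    (ρ.fixedSubmodule S).starProjection ξ ∈
      closure (convexHull ℝ ((fun g => ρ.hom g ξ) '' (stabilizer S : Set (U ≃ᵢ U)))) := by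
  obtain ⟨m, hm, hinv⟩ := exists_invariant_mem_closure ρ.hom (stabilizer S) ξ
  have : (ρ.fixedSubmodule S).starProjection ξ = m := by
    refine Submodule.eq_starProjection_of_mem_of_inner_eq_zero hinv fun η hη => ?_
    rw [inner_eq_zero_symm, inner_sub_right, sub_eq_zero]
    refine (inner_eq_of_mem_closure_convexHull ?_ hm).symm
    rintro _ ⟨g, hg, rfl⟩
    change inner ℂ η (ρ.hom g ξ) = _
    nth_rw 1 [← hη g hg, LinearIsometryEquiv.inner_map_map]
  rwa [this]

theorem hom_mem_fixedSubmodule {Λ : Set ℝ} {X : KObj.{u} Λ} {a : IsoEmb X U} {ξ : ρ.space}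
    (hξ : ξ ∈ ρ.fixedSubmodule (Set.range a.toFun)) (g : U ≃ᵢ U) :
    ρ.hom g ξ ∈ ρ.fixedSubmodule (Set.range (a.translate g).toFun) := by
  intro h hh
  have h1 : ρ.hom (g⁻¹ * h * g) ξ = ξ := by
    refine hξ _ ?_
    rintro _ ⟨x, rfl⟩
    have := hh _ ⟨x, rfl⟩
    change g.symm (h (g (a.toFun x))) = _
    rw [IsometryEquiv.symm_apply_eq]
    exact this
  have h2 : h * g = g * (g⁻¹ * h * g) := by group
  rw [← hom_mul_apply, h2, hom_mul_apply, h1]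

theorem exists_fixed_near (Λ : Set ℝ) [IsUrysohn Λ U] (ξ : ρ.space) {ε : ℝ} (hε : 0 < ε) :
    ∃ (X : KObj.{u} Λ) (a : IsoEmb X U), ∃ η ∈ ρ.fixedSubmodule (Set.range a.toFun),
      dist η ξ ≤ ε := by
  have hV : {g : U ≃ᵢ U | dist (ρ.hom g ξ) ξ < ε} ∈ nhds 1 := by
    refine (isOpen_lt ((ρ.continuous_hom ξ).dist continuous_const) continuous_const).mem_nhds ?_
    simpa using hε
  obtain ⟨F, hF, δ, hδ, h⟩ := exists_finite_of_mem_nhds_one hV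
  obtain ⟨x⟩ := IsUrysohn.nonempty Λ (U := U)
  refine ⟨subsetObj (insert x F) (hF.insert x) (Set.insert_nonempty x F), subsetEmb _ _ _, ?_⟩
  rw [range_subsetEmb]
  refine ⟨_, Submodule.starProjection_apply_mem _ ξ, ?_⟩
  have hsub : convexHull ℝ ((fun g => ρ.hom g ξ) '' (stabilizer (insert x F) : Set (U ≃ᵢ U))) ⊆
      Metric.closedBall ξ ε := by
    refine convexHull_min ?_ (convex_closedBall ξ ε)
    rintro _ ⟨g, hg, rfl⟩
    have hgV : dist (ρ.hom g ξ) ξ < ε := h g fun y hy => by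
      rw [hg y (Or.inr hy), dist_self]
      exact hδ
    exact hgV.le
  exact closure_minimal hsub Metric.isClosed_closedBall (ρ.starProjection_mem_closure _ ξ)

section Reduction

variable {Λ : Set ℝ} [IsUrysohn Λ U] {X Y Z : KObj.{u} Λ}

theorem inner_hom_eq_of_embMor_eq {a : IsoEmb X U} {b : IsoEmb Y U} {g h : U ≃ᵢ U}
    (hgh : embMor (a.translate g) b = embMor (a.translate h) b) {ξ η : ρ.space}
    (hξ : ξ ∈ ρ.fixedSubmodule (Set.range a.toFun))
    (hη : η ∈ ρ.fixedSubmodule (Set.range b.toFun)) :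
    inner ℂ η (ρ.hom g ξ) = inner ℂ η (ρ.hom h ξ) := by
  obtain ⟨k, hk, hkb⟩ := exists_translate_of_embMor_eq _ _ b hgh
  have h1 : ρ.hom (h⁻¹ * k * g) ξ = ξ := by
    refine hξ _ ?_
    rintro _ ⟨x, rfl⟩
    change h.symm (k (g (a.toFun x))) = _
    rw [IsometryEquiv.symm_apply_eq]
    exact congrArg (fun c : IsoEmb X U => c.toFun x) hk
  have h2 : k * g = h * (h⁻¹ * k * g) := by group
  rw [← (ρ.hom k).inner_map_map, hη k hkb, ← hom_mul_apply, h2,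
    hom_mul_apply, h1]

/-- The projection to `H[Y]` acts between `H[X]` and `H[Z]` as any isometry that fixes `Y` and makes
`X` independent of `Z` over `Y`. -/
theorem inner_starProjection_eq {a : IsoEmb X U} {b : IsoEmb Y U} {c : IsoEmb Z U} {g : U ≃ᵢ U}
    (hg : embMor (a.translate g) c = embMor a b ≫ embMor b c) {ξ η : ρ.space}
    (hξ : ξ ∈ ρ.fixedSubmodule (Set.range a.toFun))
    (hη : η ∈ ρ.fixedSubmodule (Set.range c.toFun)) :
    inner ℂ η ((ρ.fixedSubmodule (Set.range b.toFun)).starProjection ξ) =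
      inner ℂ η (ρ.hom g ξ) := by
  set m := (ρ.fixedSubmodule (Set.range b.toFun)).starProjection ξ with hm
  have hmb : m ∈ ρ.fixedSubmodule (Set.range b.toFun) := Submodule.starProjection_apply_mem _ ξ
  have hcl := ρ.starProjection_mem_closure (Set.range b.toFun) ξ
  refine eq_of_forall_dist_le fun ε hε => ?_
  obtain ⟨ζ, hζ, hdist⟩ := Metric.mem_closure_iff.1 hcl (ε / (‖η‖ + 1)) (by positivity)
  rw [convexHull_eq_union_convexHull_finite_subsets] at hζ
  obtain ⟨t, ht, hζt⟩ : ∃ t : Finset ρ.space, ↑t ⊆ (fun g => ρ.hom g ξ) ''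
      (stabilizer (Set.range b.toFun) : Set (U ≃ᵢ U)) ∧ ζ ∈ convexHull ℝ (t : Set ρ.space) := by
    simpa using hζ
  have : ∀ x : t, ∃ k ∈ stabilizer (Set.range b.toFun), ρ.hom k ξ = x := fun x => ht x.2
  choose k hk hkx using this
  let W : Set U := Set.range a.toFun ∪ ⋃ x : t, Set.range (a.translate (k x)).toFun
  let w : IsoEmb (subsetObj (Λ := Λ) W
    ((Set.finite_range _).union (Set.finite_iUnion fun _ => Set.finite_range _))
    (Set.range_nonempty _).inl) U := subsetEmb W _ _
  obtain ⟨h, hhb, hh⟩ := exists_translate_embMor_comp w b c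
  have key : ∀ x ∈ (t : Set ρ.space), inner ℂ (ρ.hom h⁻¹ η) x = inner ℂ η (ρ.hom g ξ) := by
    intro x hx
    have hx' := hkx ⟨x, hx⟩
    simp only at hx'
    rw [← hx', inner_hom_left, inv_inv, ← hom_mul_apply]
    refine ρ.inner_hom_eq_of_embMor_eq ?_ hξ hη
    have hsub : Set.range (a.translate (k ⟨x, hx⟩)).toFun ⊆ Set.range w.toFun := by
      rw [range_subsetEmb]
      exact (Set.subset_iUnion (fun x : t => Set.range (a.translate (k x)).toFun) _).trans
        Set.subset_union_right
    have hsub' : Set.range ((a.translate (k ⟨x, hx⟩)).translate h).toFun ⊆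
        Set.range (w.translate h).toFun := by
      rintro _ ⟨y, rfl⟩
      obtain ⟨z, hz⟩ := hsub ⟨y, rfl⟩
      exact ⟨z, congrArg h hz⟩
    have hkb : b.translate (k ⟨x, hx⟩) = b := IsoEmb.ext fun y => hk _ _ ⟨y, rfl⟩
    rw [hg, IsoEmb.translate_mul, ← embMor_comp_of_left _ _ c hsub', hh, embMor_translate,
      ← Category.assoc, embMor_comp_of_left _ _ b hsub, ← embMor_translate a b (k ⟨x, hx⟩), hkb]
  have hmh : ρ.hom h m = m := hmb h hhb
  rw [← inner_eq_of_mem_convexHull key hζt, inner_hom_left, inv_inv]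
  nth_rw 1 [← hmh]
  rw [dist_eq_norm, ← inner_sub_right, ← map_sub]
  refine (norm_inner_le_norm _ _).trans ?_
  rw [LinearIsometryEquiv.norm_map, ← dist_eq_norm]
  calc ‖η‖ * dist m ζ ≤ (‖η‖ + 1) * (ε / (‖η‖ + 1)) := by
        gcongr
        linarith
    _ = ε := by field_simp

end Reduction

end UnitaryRep

namespace UnitaryRep

variable {U : Type u} [MetricSpace U] (ρ : UnitaryRep.{u, v} U)

/-- The inclusion of `H[S]` in `H`. -/
noncomputable def fixedIncl (S : Set U) : ρ.fixed S →ₗᵢ[ℂ] ρ.space :=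
  (ρ.fixedSubmodule S).subtypeₗᵢ

/-- Invariant vectors as elements of `H[S]`. -/
noncomputable def toFixed (S : Set U) (ξ : ρ.space) (h : ξ ∈ ρ.fixedSubmodule S) : ρ.fixed S :=
  ⟨ξ, h⟩

theorem fixedIncl_toFixed (S : Set U) (ξ : ρ.space) (h : ξ ∈ ρ.fixedSubmodule S) :
    ρ.fixedIncl S (ρ.toFixed S ξ h) = ξ := rfl

theorem fixedIncl_mem (S : Set U) (ξ : ρ.fixed S) : ρ.fixedIncl S ξ ∈ ρ.fixedSubmodule S := ξ.2

theorem inner_reducedOp (S T : Set U) (g : U ≃ᵢ U) (ξ : ρ.fixed S) (η : ρ.fixed T) :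
    inner ℂ η (ρ.reducedOp S T g ξ) = inner ℂ (ρ.fixedIncl T η) (ρ.hom g (ρ.fixedIncl S ξ)) :=
  Submodule.inner_orthogonalProjectionOnto_eq_of_mem_left _ _

variable {Λ : Set ℝ} [IsUrysohn Λ U] (e : ∀ X : KObj.{u} Λ, IsoEmb X U)

/-- The operator of a morphism in the reduction of a unitary representation. -/
noncomputable def reductionOp (X Y : KObj.{u} Λ) (p : X ⟶ Y) :
    ρ.fixed (Set.range (e X).toFun) →L[ℂ] ρ.fixed (Set.range (e Y).toFun) :=
  ρ.reducedOp _ _ (exists_isometryMor_eq (e X) (e Y) p).choose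

theorem inner_reductionOp {X Y : KObj.{u} Λ} (g : U ≃ᵢ U) (ξ : ρ.fixed (Set.range (e X).toFun))
    (η : ρ.fixed (Set.range (e Y).toFun)) :
    inner ℂ η (ρ.reductionOp e X Y (isometryMor (e X) (e Y) g) ξ) =
      inner ℂ (ρ.fixedIncl _ η) (ρ.hom g (ρ.fixedIncl _ ξ)) := by
  refine (ρ.inner_reducedOp _ _ _ ξ η).trans ?_
  exact ρ.inner_hom_eq_of_embMor_eq
    (exists_isometryMor_eq (e X) (e Y) (isometryMor (e X) (e Y) g)).choose_spec ξ.2 η.2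

theorem reductionOp_isometryMor (X Y : KObj.{u} Λ) (g : U ≃ᵢ U) :
    ρ.reductionOp e X Y (isometryMor (e X) (e Y) g) = ρ.reducedOp _ _ g := by
  ext1 ξ
  refine ext_inner_left ℂ fun η => ?_
  rw [inner_reductionOp, inner_reducedOp]

theorem coe_reductionOp {X Y : KObj.{u} Λ} (g : U ≃ᵢ U) (ξ : ρ.fixed (Set.range (e X).toFun)) :
    ρ.fixedIncl _ (ρ.reductionOp e X Y (isometryMor (e X) (e Y) g) ξ) =
      (ρ.fixedSubmodule (Set.range (e Y).toFun)).starProjection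
        (ρ.hom g (ρ.fixedIncl _ ξ)) := by
  rw [reductionOp_isometryMor]
  rfl

/-- The topology on morphisms does not depend on the embeddings that define it. -/
theorem continuous_morTopology {X Y : KObj.{u} Λ} (a a' : IsoEmb X U) (b b' : IsoEmb Y U)
    (f : (X ⟶ Y) → ℂ) (hf : Continuous fun g => f (isometryMor a b g)) :
    @Continuous _ _ (morTopology a' b') _ f := by
  rw [continuous_coinduced_dom]
  obtain ⟨s, rfl⟩ := a.exists_translate_eq a'
  obtain ⟨t, rfl⟩ := b.exists_translate_eq b'
  refine (hf.comp (continuous_mul_isometry t⁻¹ s)).congr fun g => congrArg f (mor_ext fun x y => ?_)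
  rw [cross_isometryMor, cross_isometryMor, ← t.dist_eq]
  change dist (t (t.symm _)) _ = _
  rw [IsometryEquiv.apply_symm_apply]
  rfl

/-- The reduction of a unitary representation of the group of isometries. -/
noncomputable def reduction : StarRep.{u, v} Λ U where
  space X := ρ.fixed (Set.range (e X).toFun)
  op := ρ.reductionOp e
  op_comp X Y Z p q := by
    obtain ⟨g, rfl⟩ := exists_isometryMor_eq (e X) (e Y) p
    obtain ⟨h, rfl⟩ := exists_isometryMor_eq (e Y) (e Z) q
    obtain ⟨k, hkb, hk⟩ := exists_translate_embMor_comp ((e X).translate g) (e Y)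
      ((e Z).translate h⁻¹)
    have hcomp : isometryMor (e X) (e Y) g ≫ isometryMor (e Y) (e Z) h =
        isometryMor (e X) (e Z) (h * (k * g)) := by
      rw [isometryMor_eq_embMor, isometryMor_eq_embMor _ _ h, embMor_translate_left _ _ h, ← hk,
        isometryMor_eq_embMor, IsoEmb.translate_mul h, embMor_translate_left _ _ h,
        IsoEmb.translate_mul]
    ext1 ξ
    refine ext_inner_left ℂ fun η : ρ.fixed _ => ?_
    rw [hcomp, inner_reductionOp, ContinuousLinearMap.comp_apply, inner_reductionOp,
      coe_reductionOp, hom_mul_apply, hom_mul_apply, ← inv_inv h, ← inner_hom_left,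
      ← inner_hom_left]
    exact (ρ.inner_starProjection_eq hk (ρ.hom_mem_fixedSubmodule ξ.2 g)
      (ρ.hom_mem_fixedSubmodule η.2 h⁻¹)).symm
  op_star X Y p := by
    obtain ⟨g, rfl⟩ := exists_isometryMor_eq (e X) (e Y) p
    have hstar : morStar (isometryMor (e X) (e Y) g) = isometryMor (e Y) (e X) g⁻¹ := by
      rw [isometryMor_eq_embMor, morStar_embMor, isometryMor_eq_embMor, embMor_translate_left,
        inv_inv]
    refine ((ContinuousLinearMap.eq_adjoint_iff _ _).2 fun η ξ => ?_).symm
    rw [inner_reductionOp, hstar, ← inner_conj_symm, inner_reductionOp, ← inner_hom_left,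
      inner_conj_symm]
  nondegenerate X := by
    ext1 ξ
    refine ext_inner_left ℂ fun η => ?_
    rw [← embMor_self (e X), embMor, inner_reductionOp, map_one]
    rfl
  continuous_op X Y a b ξ η := by
    refine continuous_morTopology (e X) a (e Y) b _ ?_
    simp only [inner_reductionOp]
    exact continuous_const.inner (ρ.continuous_hom _)

theorem isReduction_reduction : IsReduction e ρ (ρ.reduction e).toOperatorFamily :=
  ⟨ρ.reductionOp e, rfl, ρ.reductionOp_isometryMor e⟩

end UnitaryRep

namespace UnitaryRep

variable {U : Type u} [MetricSpace U]

/-- Operators commuting with the action of `g` on a total set commute with it. -/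
theorem intertwines_of_total {ι : Type*} {ρ ρ' : UnitaryRep.{u, v} U} (f : ι → ρ.space)
    (hf : Dense (Submodule.span ℂ (Set.range f) : Set ρ.space)) (V : ρ.space ≃ₗᵢ[ℂ] ρ'.space)
    (g : U ≃ᵢ U) (h : ∀ i, V (ρ.hom g (f i)) = ρ'.hom g (V (f i))) (ξ : ρ.space) :
    V (ρ.hom g ξ) = ρ'.hom g (V ξ) := by
  have : (((ρ.hom g).trans V).toContinuousLinearEquiv : ρ.space →L[ℂ] ρ'.space) =
      ((V.trans (ρ'.hom g)).toContinuousLinearEquiv : ρ.space →L[ℂ] ρ'.space) := by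
    refine ContinuousLinearMap.ext_on hf ?_
    rintro _ ⟨i, rfl⟩
    exact h i
  exact congrArg (fun T : ρ.space →L[ℂ] ρ'.space => T ξ) this

variable {Λ : Set ℝ} [IsUrysohn Λ U]

theorem reduction_equiv_iff {ρ ρ' : UnitaryRep.{u, v} U} {e e' : ∀ X : KObj.{u} Λ, IsoEmb X U} :
    ρ.reduction e ≈ ρ'.reduction e' ↔ ∃ V : ∀ X, ρ.fixed (Set.range (e X).toFun) ≃ₗᵢ[ℂ]
      ρ'.fixed (Set.range (e' X).toFun), ∀ (X Y : KObj.{u} Λ) (p : X ⟶ Y)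
        (ξ : ρ.fixed (Set.range (e X).toFun)),
        V Y (ρ.reductionOp e X Y p ξ) = ρ'.reductionOp e' X Y p (V X ξ) := Iff.rfl

theorem reduction_equiv {ρ ρ' : UnitaryRep.{u, v} U} (h : ρ ≈ ρ')
    (e e' : ∀ X : KObj.{u} Λ, IsoEmb X U) : ρ.reduction e ≈ ρ'.reduction e' := by
  obtain ⟨W, hW⟩ := h
  have hs : ∀ X, ∃ s : U ≃ᵢ U, (e X).translate s = e' X := fun X => (e X).exists_translate_eq (e' X)
  choose s hs using hs
  have hW' : ∀ g η, W.symm (ρ'.hom g η) = ρ.hom g (W.symm η) := fun g η => by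
    rw [LinearIsometryEquiv.symm_apply_eq, hW, LinearIsometryEquiv.apply_symm_apply]
  have h1 : ∀ X, ∀ ξ : ρ.fixed (Set.range (e X).toFun),
      W (ρ.hom (s X) (ρ.fixedIncl _ ξ)) ∈ ρ'.fixedSubmodule (Set.range (e' X).toFun) := by
    intro X ξ g hg
    rw [← hW, ← hs] at *
    rw [ρ.hom_mem_fixedSubmodule (ρ.fixedIncl_mem _ ξ) (s X) g hg]
  have hs' : ∀ X, (e' X).translate (s X)⁻¹ = e X := fun X => by
    rw [← hs, ← IsoEmb.translate_mul, inv_mul_cancel, IsoEmb.translate_one]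
  have h2 : ∀ X, ∀ η : ρ'.fixed (Set.range (e' X).toFun),
      W.symm (ρ'.hom (s X)⁻¹ (ρ'.fixedIncl _ η)) ∈ ρ.fixedSubmodule (Set.range (e X).toFun) := by
    intro X η g hg
    rw [← hs'] at hg
    rw [← hW', ρ'.hom_mem_fixedSubmodule (ρ'.fixedIncl_mem _ η) (s X)⁻¹ g hg]
  let V : ∀ X, ρ.fixed (Set.range (e X).toFun) →ₗᵢ[ℂ] ρ'.fixed (Set.range (e' X).toFun) := fun X =>
    { toLinearMap := LinearMap.codRestrict (ρ'.fixedSubmodule _)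
        (((ρ.hom (s X)).trans W).toLinearEquiv.toLinearMap ∘ₗ (ρ.fixedIncl _).toLinearMap) (h1 X)
      norm_map' := fun ξ => (((ρ.hom (s X)).trans W).norm_map _) }
  have hV : ∀ X ξ, ρ'.fixedIncl _ (V X ξ) = W (ρ.hom (s X) (ρ.fixedIncl _ ξ)) := fun _ _ => rfl
  have hsurj : ∀ X, Function.Surjective (V X) := by
    intro X η
    refine ⟨ρ.toFixed _ _ (h2 X η), (ρ'.fixedIncl _).injective ?_⟩
    rw [hV, fixedIncl_toFixed, hW, LinearIsometryEquiv.apply_symm_apply, ← hom_mul_apply,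
      mul_inv_cancel, map_one]
    rfl
  refine reduction_equiv_iff.2
    ⟨fun X => LinearIsometryEquiv.ofSurjective (V X) (hsurj X), fun X Y p ξ => ?_⟩
  change V Y (ρ.reductionOp e X Y p ξ) = ρ'.reductionOp e' X Y p (V X ξ)
  refine ext_inner_left ℂ fun η => ?_
  obtain ⟨η, rfl⟩ := hsurj Y η
  obtain ⟨g, rfl⟩ := exists_isometryMor_eq (e X) (e Y) p
  have hg : isometryMor (e X) (e Y) g = isometryMor (e' X) (e' Y) (s Y * (g * (s X)⁻¹)) := by
    rw [isometryMor_eq_embMor, isometryMor_eq_embMor, IsoEmb.translate_mul, IsoEmb.translate_mul,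
      hs', ← hs Y, embMor_translate]
  rw [LinearIsometry.inner_map_map, inner_reductionOp, hg, inner_reductionOp, hV, hV, ← hW,
    LinearIsometryEquiv.inner_map_map, ← hom_mul_apply, inner_hom_left, ← hom_mul_apply]
  congr 3
  group

theorem dense_span_hom_fixed (ρ : UnitaryRep.{u, v} U) (e : ∀ X : KObj.{u} Λ, IsoEmb X U) :
    Dense (Submodule.span ℂ (Set.range
      fun i : Σ X : KObj.{u} Λ, (U ≃ᵢ U) × ρ.fixed (Set.range (e X).toFun) =>
        ρ.hom i.2.1 (ρ.fixedIncl _ i.2.2)) : Set ρ.space) := by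
  intro ξ
  refine Metric.mem_closure_iff.2 fun ε hε => ?_
  obtain ⟨X, a, η, hη, hd⟩ := ρ.exists_fixed_near Λ ξ (half_pos hε)
  obtain ⟨g, hg⟩ := a.exists_translate_eq (e X)
  refine ⟨η, Submodule.subset_span ⟨⟨X, g⁻¹, ⟨ρ.hom g η, ?_⟩⟩, ?_⟩, ?_⟩
  · rw [← hg]
    exact ρ.hom_mem_fixedSubmodule hη g
  · change ρ.hom g⁻¹ (ρ.hom g η) = η
    rw [← hom_mul_apply, inv_mul_cancel, map_one]
    rfl
  · rw [dist_comm]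
    linarith

theorem equiv_of_reduction_equiv {ρ ρ' : UnitaryRep.{u, v} U} (e : ∀ X : KObj.{u} Λ, IsoEmb X U)
    (h : ρ.reduction e ≈ ρ'.reduction e) : ρ ≈ ρ' := by
  obtain ⟨V, hV⟩ := reduction_equiv_iff.1 h
  let f := fun i : Σ X : KObj.{u} Λ, (U ≃ᵢ U) × ρ.fixed (Set.range (e X).toFun) =>
    ρ.hom i.2.1 (ρ.fixedIncl _ i.2.2)
  let f' := fun i : Σ X : KObj.{u} Λ, (U ≃ᵢ U) × ρ.fixed (Set.range (e X).toFun) =>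
    ρ'.hom i.2.1 (ρ'.fixedIncl _ (V i.1 i.2.2))
  have hf : Dense (Submodule.span ℂ (Set.range f) : Set ρ.space) := ρ.dense_span_hom_fixed e
  have hf' : Dense (Submodule.span ℂ (Set.range f') : Set ρ'.space) := by
    refine (ρ'.dense_span_hom_fixed e).mono (Submodule.span_mono ?_)
    rintro _ ⟨⟨X, g, η⟩, rfl⟩
    refine ⟨⟨X, g, (V X).symm η⟩, ?_⟩
    change ρ'.hom g (ρ'.fixedIncl _ (V X ((V X).symm η))) = _
    rw [LinearIsometryEquiv.apply_symm_apply]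
  obtain ⟨W, hW⟩ := exists_unitary_of_gram f f' hf hf' (by
    rintro ⟨X, g, ξ⟩ ⟨Y, h, η⟩
    change inner ℂ (ρ.hom g (ρ.fixedIncl _ ξ)) (ρ.hom h (ρ.fixedIncl _ η)) =
      inner ℂ (ρ'.hom g (ρ'.fixedIncl _ (V X ξ))) (ρ'.hom h (ρ'.fixedIncl _ (V Y η)))
    rw [inner_hom_left, inner_hom_left, ← hom_mul_apply, ← hom_mul_apply,
      ← inner_reductionOp, ← inner_reductionOp, ← hV, ← (V X).inner_map_map])
  refine ⟨W, fun g => intertwines_of_total f hf W g ?_⟩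
  rintro ⟨X, h, ξ⟩
  have h1 : ρ.hom g (f ⟨X, h, ξ⟩) = f ⟨X, g * h, ξ⟩ := (ρ.hom_mul_apply g h _).symm
  rw [h1, hW, hW]
  exact ρ'.hom_mul_apply g h _

end UnitaryRep

section Approximation

/-- Finite subsets of an Urysohn space can be moved into a dense set by small isometries. -/
theorem IsUrysohn.exists_isometry_into_dense (Λ : Set ℝ) {U : Type u} [MetricSpace U]
    [IsUrysohn Λ U] {D : Set U} (hD : Dense D) {F : Set U} (hF : F.Finite) {ε : ℝ} (hε : 0 < ε) :
    ∃ g : U ≃ᵢ U, ∀ x ∈ F, g x ∈ D ∧ dist (g x) x < ε := by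
  have : IsUltrametricDist U := IsUrysohn.ultra Λ
  obtain ⟨δ, hδ, hδε, hδF⟩ : ∃ δ > 0, δ ≤ ε ∧ ∀ x ∈ F, ∀ y ∈ F, x ≠ y → δ ≤ dist x y := by
    have h1 : ∀ᶠ δ : ℝ in nhdsWithin 0 (Set.Ioi 0), ∀ x ∈ F, ∀ y ∈ F, x ≠ y → δ ≤ dist x y := by
      refine (Filter.eventually_all_finite hF).2 fun x _ =>
        (Filter.eventually_all_finite hF).2 fun y _ => ?_
      by_cases hxy : x = y
      · exact Filter.Eventually.of_forall fun δ h => (h hxy).elim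
      · exact Filter.mem_of_superset (Ioc_mem_nhdsGT (dist_pos.2 hxy)) fun δ hδ _ => hδ.2
    have h2 : ∀ᶠ δ : ℝ in nhdsWithin 0 (Set.Ioi 0), δ ≤ ε :=
      Filter.mem_of_superset (Ioc_mem_nhdsGT hε) fun δ hδ => hδ.2
    exact ((eventually_mem_nhdsWithin (a := (0 : ℝ))).and (h2.and h1)).exists
  have hs : ∀ x : U, ∃ y ∈ D, dist x y < δ := fun x => hD.exists_dist_lt x hδ
  choose s hsD hs using hs
  obtain ⟨g, hg⟩ := IsUrysohn.exists_extend Λ ((fun x => (x, s x)) '' F) (hF.image _) (by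
    rintro _ ⟨x, hx, rfl⟩ _ ⟨y, hy, rfl⟩
    by_cases hxy : x = y
    · simp [hxy]
    · have h0 := hδF x hx y hy hxy
      have h1 := hs x
      have h2 := hs y
      have h3 := IsUltrametricDist.dist_triangle_max x (s x) y
      have h4 := IsUltrametricDist.dist_triangle_max (s x) (s y) y
      have h5 := IsUltrametricDist.dist_triangle_max (s x) x (s y)
      have h6 := IsUltrametricDist.dist_triangle_max x y (s y)
      rw [dist_comm (s y) y] at h4
      rw [dist_comm (s x) x] at h5
      change dist x y = dist (s x) (s y)
      grind)
  refine ⟨g, fun x hx => ?_⟩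
  have : g x = s x := hg _ ⟨x, hx, rfl⟩
  rw [this, dist_comm]
  exact ⟨hsD x, (hs x).trans_le hδε⟩

end Approximation

section Reconstruction

variable {Λ : Set ℝ} {U : Type u} [MetricSpace U] [IsUrysohn Λ U] (τ : StarRep.{u, v} Λ U)

theorem StarRep.inner_op_right {X Y : KObj.{u} Λ} (a : IsoEmb X U) (b : IsoEmb Y U)
    (ξ : τ.space X) (η : τ.space Y) :
    inner ℂ η (τ.op X Y (embMor a b) ξ) = inner ℂ (τ.op Y X (embMor b a) η) ξ := by
  rw [← morStar_embMor b a, ← τ.op_star, ContinuousLinearMap.adjoint_inner_right]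

/-- A vector of `τ(X)` together with an embedding of `X`. -/
abbrev StarRep.Index : Type (max (u + 1) v) := Σ X : KObj.{u} Λ, IsoEmb X U × τ.space X

/-- A family in a Hilbert space whose Gram matrix is given by the operators of `τ`. -/
structure StarRep.IsGNS {H : Type*} [NormedAddCommGroup H] [InnerProductSpace ℂ H]
    (f : τ.Index → H) : Prop where
  dense : Dense (Submodule.span ℂ (Set.range f) : Set H)
  inner_eq : ∀ (X Y : KObj.{u} Λ) (a : IsoEmb X U) (b : IsoEmb Y U) (ξ : τ.space X)
    (η : τ.space Y), inner ℂ (f ⟨Y, b, η⟩) (f ⟨X, a, ξ⟩) = inner ℂ η (τ.op X Y (embMor a b) ξ)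

theorem StarRep.exists_isGNS : ∃ (H : Type (max (u + 1) v)) (_ : NormedAddCommGroup H)
    (_ : InnerProductSpace ℂ H) (_ : CompleteSpace H) (f : τ.Index → H), τ.IsGNS f := by
  obtain ⟨H, i1, i2, i3, f, hf, hK⟩ := exists_family_of_kernel
    (fun i j : τ.Index => inner ℂ i.2.2 (τ.op j.1 i.1 (embMor j.2.1 i.2.1) j.2.2))
    (fun i j => by rw [inner_conj_symm, ← τ.inner_op_right]) (by
      intro c
      obtain ⟨u₀⟩ := IsUrysohn.nonempty Λ (U := U)
      let S : Set U := insert u₀ (⋃ i ∈ c.support, Set.range i.2.1.toFun)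
      have hS : S.Finite := (c.support.finite_toSet.biUnion fun i _ => Set.finite_range _).insert u₀
      let d : IsoEmb (subsetObj (Λ := Λ) S hS (Set.insert_nonempty _ _)) U := subsetEmb S _ _
      have hd : ∀ i ∈ c.support, Set.range i.2.1.toFun ⊆ Set.range d.toFun := by
        intro i hi
        rw [range_subsetEmb]
        exact (Set.subset_biUnion_of_mem (u := fun i : τ.Index => Set.range i.2.1.toFun) hi).trans
          (Set.subset_insert _ _)
      have key : (c.sum fun i a => c.sum fun j b => (starRingEnd ℂ) a * b *
          inner ℂ i.2.2 (τ.op j.1 i.1 (embMor j.2.1 i.2.1) j.2.2)) =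
          inner ℂ (c.sum fun i a => a • τ.op i.1 _ (embMor i.2.1 d) i.2.2)
            (c.sum fun i a => a • τ.op i.1 _ (embMor i.2.1 d) i.2.2) := by
        simp only [Finsupp.sum, sum_inner, inner_sum, inner_smul_left, inner_smul_right]
        rw [Finset.sum_comm]
        refine Finset.sum_congr rfl fun j hj => ?_
        rw [Finset.mul_sum]
        refine Finset.sum_congr rfl fun i hi => ?_
        rw [← embMor_comp_of_left j.2.1 d i.2.1 (hd j hj), τ.op_comp,
          ContinuousLinearMap.comp_apply, τ.inner_op_right d i.2.1]
        ring
      rw [key]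
      exact inner_self_nonneg (𝕜 := ℂ))
  exact ⟨H, i1, i2, i3, f, hf, fun X Y a b ξ η => hK _ _⟩

namespace StarRep.IsGNS

variable {τ} {H : Type*} [NormedAddCommGroup H] [InnerProductSpace ℂ H] {f : τ.Index → H}

theorem inner_self_eq (hf : τ.IsGNS f) {X : KObj.{u} Λ} (a : IsoEmb X U) (ξ η : τ.space X) :
    inner ℂ (f ⟨X, a, ξ⟩) (f ⟨X, a, η⟩) = inner ℂ ξ η := by
  rw [hf.inner_eq, embMor_self, τ.nondegenerate, ContinuousLinearMap.id_apply]

theorem norm_eq (hf : τ.IsGNS f) {X : KObj.{u} Λ} (a : IsoEmb X U) (ξ : τ.space X) :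
    ‖f ⟨X, a, ξ⟩‖ = ‖ξ‖ := by
  rw [norm_eq_sqrt_re_inner (𝕜 := ℂ), hf.inner_self_eq, ← norm_eq_sqrt_re_inner (𝕜 := ℂ)]

theorem isometry (hf : τ.IsGNS f) {X : KObj.{u} Λ} (a : IsoEmb X U) :
    Isometry fun ξ => f ⟨X, a, ξ⟩ := by
  refine Isometry.of_dist_eq fun ξ η => ?_
  rw [dist_eq_norm, dist_eq_norm, ← sq_eq_sq₀ (norm_nonneg _) (norm_nonneg _),
    norm_sub_sq (𝕜 := ℂ), norm_sub_sq (𝕜 := ℂ), hf.inner_self_eq, hf.norm_eq, hf.norm_eq]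

theorem continuous_translate (hf : τ.IsGNS f) {X : KObj.{u} Λ} (a : IsoEmb X U) (ξ : τ.space X) :
    Continuous fun g : U ≃ᵢ U => f ⟨X, a.translate g, ξ⟩ := by
  refine continuous_iff_continuousAt.2 fun g₀ => ?_
  have h1 : Continuous fun g : U ≃ᵢ U =>
      inner ℂ (f ⟨X, a.translate g₀, ξ⟩) (f ⟨X, a.translate g, ξ⟩) := by
    simp only [hf.inner_eq]
    have h0 := τ.continuous_op X X a (a.translate g₀) ξ ξ
    rw [continuous_coinduced_dom] at h0
    exact h0
  have h2 : Continuous fun g : U ≃ᵢ U =>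
      ‖f ⟨X, a.translate g₀, ξ⟩ - f ⟨X, a.translate g, ξ⟩‖ ^ 2 := by
    simp only [norm_sub_sq (𝕜 := ℂ), hf.norm_eq]
    exact (continuous_const.sub (continuous_const.mul (Complex.continuous_re.comp h1))).add
      continuous_const
  have h3 : Continuous fun g : U ≃ᵢ U =>
      ‖f ⟨X, a.translate g₀, ξ⟩ - f ⟨X, a.translate g, ξ⟩‖ := by
    refine (Real.continuous_sqrt.comp h2).congr fun g => ?_
    exact Real.sqrt_sq (norm_nonneg _)
  refine tendsto_iff_norm_sub_tendsto_zero.2 ?_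
  have h4 := h3.tendsto g₀
  simp only [sub_self, norm_zero] at h4
  simpa only [norm_sub_rev] using h4

theorem ext (hf : τ.IsGNS f) {x y : H} (h : ∀ i, inner ℂ (f i) x = inner ℂ (f i) y) : x = y := by
  refine hf.dense.eq_of_inner_right ℂ fun z hz => ?_
  induction hz using Submodule.span_induction with
  | mem z hz =>
    obtain ⟨i, rfl⟩ := hz
    exact h i
  | zero => simp
  | add z w _ _ hz hw => rw [inner_add_left, inner_add_left, hz, hw]
  | smul c z _ hz => rw [inner_smul_left, inner_smul_left, hz]

theorem apply_eq_of_subset (hf : τ.IsGNS f) {X Y : KObj.{u} Λ} (a : IsoEmb X U) (b : IsoEmb Y U)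
    (h : Set.range a.toFun ⊆ Set.range b.toFun) (ξ : τ.space X) :
    f ⟨X, a, ξ⟩ = f ⟨Y, b, τ.op X Y (embMor a b) ξ⟩ := by
  refine hf.ext ?_
  rintro ⟨Z, c, ζ⟩
  rw [hf.inner_eq, hf.inner_eq, ← embMor_comp_of_left a b c h, τ.op_comp,
    ContinuousLinearMap.comp_apply]

theorem separableSpace (hf : τ.IsGNS f) : TopologicalSpace.SeparableSpace H := by
  have : TopologicalSpace.SeparableSpace U := IsUrysohn.separable Λ
  obtain ⟨D, hDc, hD⟩ := TopologicalSpace.exists_countable_dense U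
  have : Countable D := hDc.to_subtype
  let ι := {S : Finset D // S.Nonempty}
  have hSf : ∀ S : ι, (Subtype.val '' (S.1 : Set D)).Finite := fun S => S.1.finite_toSet.image _
  have hSn : ∀ S : ι, (Subtype.val '' (S.1 : Set D)).Nonempty := fun S =>
    (Finset.coe_nonempty.2 S.2).image _
  let A : Set H := ⋃ S : ι, Set.range fun ξ => f ⟨_, subsetEmb (Λ := Λ) _ (hSf S) (hSn S), ξ⟩
  have hA : TopologicalSpace.IsSeparable A := TopologicalSpace.IsSeparable.iUnion fun S =>
    TopologicalSpace.isSeparable_range (hf.isometry _).continuous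
  have h1 : ∀ i, f i ∈ closure A := by
    rintro ⟨X, a, ξ⟩
    let B : Set (U ≃ᵢ U) := {g | ∀ x, g (a.toFun x) ∈ D}
    have hB : (1 : U ≃ᵢ U) ∈ closure B := by
      refine mem_closure_iff_nhds.2 fun V hV => ?_
      obtain ⟨F, hF, ε, hε, hFV⟩ := exists_finite_of_mem_nhds_one hV
      obtain ⟨g, hg⟩ := IsUrysohn.exists_isometry_into_dense Λ hD
        (hF.union (Set.finite_range a.toFun)) hε
      exact ⟨g, hFV g fun x hx => (hg x (Or.inl hx)).2, fun x => (hg _ (Or.inr ⟨x, rfl⟩)).1⟩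
    refine map_mem_closure (f := fun g => f ⟨X, a.translate g, ξ⟩)
      (hf.continuous_translate a ξ) hB fun g hg => ?_
    classical
    have := Fintype.ofFinite X
    let S : ι := ⟨Finset.univ.image fun x => ⟨g (a.toFun x), hg x⟩,
      Finset.univ_nonempty.image _⟩
    have hS : Set.range (a.translate g).toFun ⊆
        Set.range (subsetEmb (Λ := Λ) _ (hSf S) (hSn S)).toFun := by
      rw [range_subsetEmb]
      rintro _ ⟨x, rfl⟩
      exact ⟨⟨g (a.toFun x), hg x⟩, by simp [S], rfl⟩
    exact Set.mem_iUnion.2 ⟨S, ⟨_, (hf.apply_eq_of_subset _ _ hS ξ).symm⟩⟩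
  have h2 : Dense (closure (Submodule.span ℂ A : Set H)) := by
    refine hf.dense.mono ?_
    have : Submodule.span ℂ (Set.range f) ≤ (Submodule.span ℂ A).topologicalClosure := by
      refine Submodule.span_le.2 ?_
      rintro _ ⟨i, rfl⟩
      exact closure_mono Submodule.subset_span (h1 i)
    exact this
  have h3 : TopologicalSpace.IsSeparable (Set.univ : Set H) := by
    rw [← h2.closure_eq]
    exact ((hA.span (R := ℂ)).closure).closure
  exact TopologicalSpace.isSeparable_univ_iff.1 h3

end StarRep.IsGNS

theorem StarRep.exists_isGNS_hilb : ∃ (H : Hilb.{v}) (f : τ.Index → H), τ.IsGNS f := by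
  obtain ⟨H, _, _, _, f, hf⟩ := τ.exists_isGNS
  have := hf.separableSpace
  obtain ⟨H', ⟨φ⟩⟩ := exists_hilb_equiv.{v} H
  refine ⟨H', fun i => φ (f i), ?_, fun X Y a b ξ η => ?_⟩
  · have h1 : Submodule.span ℂ (Set.range fun i => φ (f i)) =
        (Submodule.span ℂ (Set.range f)).map φ.toLinearEquiv.toLinearMap := by
      rw [Submodule.map_span, ← Set.range_comp]
      rfl
    rw [h1, Submodule.map_coe]
    exact φ.surjective.denseRange.dense_image φ.continuous hf.dense
  · rw [φ.inner_map_map, hf.inner_eq]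

end Reconstruction

section Reconstruction

variable {Λ : Set ℝ} {U : Type u} [MetricSpace U] [IsUrysohn Λ U] {τ : StarRep.{u, v} Λ U}

/-- The action of an isometry on the index set of a GNS family. -/
def StarRep.translateIndex (g : U ≃ᵢ U) (i : τ.Index) : τ.Index := ⟨i.1, i.2.1.translate g, i.2.2⟩

/-- The unitary representation acting on a GNS family by translations. -/
theorem StarRep.IsGNS.exists_unitaryRep {H : Hilb.{v}} {f : τ.Index → H} (hf : τ.IsGNS f) :
    ∃ ρ : (U ≃ᵢ U) →* (H ≃ₗᵢ[ℂ] H), (∀ ξ, Continuous fun g => ρ g ξ) ∧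
      ∀ g i, ρ g (f i) = f (StarRep.translateIndex g i) := by
  have hsurj : ∀ g : U ≃ᵢ U, Function.Surjective (StarRep.translateIndex (τ := τ) g) := by
    intro g i
    refine ⟨StarRep.translateIndex g⁻¹ i, ?_⟩
    obtain ⟨X, a, ξ⟩ := i
    change (⟨X, (a.translate g⁻¹).translate g, ξ⟩ : τ.Index) = _
    rw [← IsoEmb.translate_mul, mul_inv_cancel, IsoEmb.translate_one]
  have hV : ∀ g : U ≃ᵢ U, ∃ V : H ≃ₗᵢ[ℂ] H, ∀ i, V (f i) = f (StarRep.translateIndex g i) := by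
    intro g
    refine exists_unitary_of_gram f (fun i => f (StarRep.translateIndex g i)) hf.dense ?_ ?_
    · rw [show (fun i => f (StarRep.translateIndex g i)) = f ∘ StarRep.translateIndex g from rfl,
        (hsurj g).range_comp]
      exact hf.dense
    · rintro ⟨X, a, ξ⟩ ⟨Y, b, η⟩
      change _ = inner ℂ (f ⟨X, a.translate g, ξ⟩) (f ⟨Y, b.translate g, η⟩)
      rw [hf.inner_eq, hf.inner_eq, embMor_translate]
  choose V hV using hV
  have hext : ∀ T T' : H ≃ₗᵢ[ℂ] H, (∀ i, T (f i) = T' (f i)) → T = T' := by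
    intro T T' h
    have : (T.toContinuousLinearEquiv : H →L[ℂ] H) = T'.toContinuousLinearEquiv := by
      refine ContinuousLinearMap.ext_on hf.dense ?_
      rintro _ ⟨i, rfl⟩
      exact h i
    ext ξ
    exact congrArg (fun T : H →L[ℂ] H => T ξ) this
  let ρ : (U ≃ᵢ U) →* (H ≃ₗᵢ[ℂ] H) :=
    { toFun := V
      map_one' := hext _ _ fun i => hV 1 i
      map_mul' := fun g h => hext _ _ fun i => by
        change V (g * h) (f i) = V g (V h (f i))
        rw [hV, hV, hV]
        rfl }
  refine ⟨ρ, fun ξ => ?_, hV⟩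
  have hspan : ∀ η ∈ Submodule.span ℂ (Set.range f), Continuous fun g => V g η := by
    intro η hη
    induction hη using Submodule.span_induction with
    | mem η hη =>
      obtain ⟨⟨X, a, η⟩, rfl⟩ := hη
      simp only [hV]
      exact hf.continuous_translate a η
    | zero => simpa using continuous_const
    | add z w _ _ hz hw =>
      simp only [map_add]
      exact Continuous.add hz hw
    | smul c z _ hz =>
      simp only [map_smul]
      exact Continuous.const_smul hz c
  refine continuous_of_uniform_approx_of_continuous fun u hu => ?_
  obtain ⟨ε, hε, hεu⟩ := Metric.mem_uniformity_dist.1 hu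
  obtain ⟨η, hη, hd⟩ := hf.dense.exists_dist_lt ξ hε
  refine ⟨_, hspan η hη, fun g => hεu ?_⟩
  change dist (V g ξ) (V g η) < ε
  rwa [LinearIsometryEquiv.dist_map]

theorem StarRep.IsGNS.mem_fixedSubmodule {ρ : UnitaryRep.{u, v} U} {f : τ.Index → ρ.space}
    (hρ : ∀ g i, ρ.hom g (f i) = f (StarRep.translateIndex g i)) {X : KObj.{u} Λ}
    (a : IsoEmb X U) (ξ : τ.space X) :
    f ⟨X, a, ξ⟩ ∈ ρ.fixedSubmodule (Set.range a.toFun) := by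
  intro g hg
  rw [hρ]
  change f ⟨X, a.translate g, ξ⟩ = _
  rw [show a.translate g = a from IsoEmb.ext fun x => hg _ ⟨x, rfl⟩]

theorem StarRep.IsGNS.starProjection_apply {ρ : UnitaryRep.{u, v} U} {f : τ.Index → ρ.space}
    (hf : τ.IsGNS f) (hρ : ∀ g i, ρ.hom g (f i) = f (StarRep.translateIndex g i))
    {X Y : KObj.{u} Λ} (a : IsoEmb X U) (b : IsoEmb Y U) (ξ : τ.space X) :
    (ρ.fixedSubmodule (Set.range b.toFun)).starProjection (f ⟨X, a, ξ⟩) =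
      f ⟨Y, b, τ.op X Y (embMor a b) ξ⟩ := by
  refine hf.ext ?_
  rintro ⟨Z, c, ζ⟩
  obtain ⟨k, -, hk⟩ := exists_translate_embMor_comp a b c
  rw [ρ.inner_starProjection_eq hk (StarRep.IsGNS.mem_fixedSubmodule hρ a ξ)
    (StarRep.IsGNS.mem_fixedSubmodule hρ c ζ), hρ]
  change inner ℂ _ (f ⟨X, a.translate k, ξ⟩) = _
  rw [hf.inner_eq, hf.inner_eq, hk, τ.op_comp, ContinuousLinearMap.comp_apply]

/-- Each `*`-representation is equivalent to the reduction of a unitary representation. -/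
theorem StarRep.exists_reduction_equiv (τ : StarRep.{u, v} Λ U)
    (e : ∀ X : KObj.{u} Λ, IsoEmb X U) : ∃ ρ : UnitaryRep.{u, v} U, ρ.reduction e ≈ τ := by
  obtain ⟨ρ, f, hf, hρ⟩ : ∃ (ρ : UnitaryRep.{u, v} U) (f : τ.Index → ρ.space), τ.IsGNS f ∧
      ∀ g i, ρ.hom g (f i) = f (StarRep.translateIndex g i) := by
    obtain ⟨H, f, hf⟩ := τ.exists_isGNS_hilb
    obtain ⟨hom, hc, hρ⟩ := hf.exists_unitaryRep
    exact ⟨⟨H, hom, hc⟩, f, hf, hρ⟩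
  refine ⟨ρ, Setoid.symm ?_⟩
  let w : ∀ X, τ.space X → ρ.fixed (Set.range (e X).toFun) := fun X ξ =>
    ρ.toFixed _ (f ⟨X, e X, ξ⟩) (StarRep.IsGNS.mem_fixedSubmodule hρ (e X) ξ)
  have hw : ∀ X ξ, ρ.fixedIncl _ (w X ξ) = f ⟨X, e X, ξ⟩ := fun _ _ => rfl
  have hdense : ∀ X, Dense (Submodule.span ℂ (Set.range (w X)) :
      Set (ρ.fixed (Set.range (e X).toFun))) := by
    intro X
    let P : ρ.space →L[ℂ] ρ.fixed (Set.range (e X).toFun) :=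
      (ρ.fixedSubmodule (Set.range (e X).toFun)).orthogonalProjectionOnto
    have hPs : Function.Surjective P := fun ξ => ⟨ρ.fixedIncl _ ξ,
      Submodule.orthogonalProjectionOnto_mem_subspace_eq_self (K := ρ.fixedSubmodule _) ξ⟩
    refine (hPs.denseRange.dense_image P.continuous hf.dense).mono ?_
    have : (Submodule.span ℂ (Set.range f)).map P.toLinearMap ≤
        Submodule.span ℂ (Set.range (w X)) := by
      rw [Submodule.map_span, Submodule.span_le]
      rintro _ ⟨_, ⟨⟨Y, b, η⟩, rfl⟩, rfl⟩
      refine Submodule.subset_span ⟨τ.op Y X (embMor b (e X)) η, (ρ.fixedIncl _).injective ?_⟩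
      rw [hw]
      exact (hf.starProjection_apply hρ b (e X) η).symm
    exact this
  have hV : ∀ X, ∃ V : τ.space X ≃ₗᵢ[ℂ] ρ.fixed (Set.range (e X).toFun), ∀ ξ, V ξ = w X ξ := by
    intro X
    refine exists_unitary_of_gram (fun ξ : τ.space X => ξ) (w X) (by simp) (hdense X) ?_
    intro ξ η
    rw [← (ρ.fixedIncl _).inner_map_map, hw, hw, hf.inner_self_eq]
  choose V hV using hV
  refine ⟨V, fun X Y p ξ => ?_⟩
  change V Y (τ.op X Y p ξ) = ρ.reductionOp e X Y p (V X ξ)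
  obtain ⟨g, rfl⟩ := exists_isometryMor_eq (e X) (e Y) p
  refine (ρ.fixedIncl _).injective ?_
  rw [ρ.coe_reductionOp, hV, hV, hw, hw]
  refine .trans ?_ (congrArg _ (hρ g _).symm)
  exact (hf.starProjection_apply hρ ((e X).translate g) (e Y) ξ).symm

end Reconstruction

end UltraUrysohn

theorem mainTheorem3 (Λ : Set ℝ) (U : Type u) [MetricSpace U]
    [UltraUrysohn.IsUrysohn Λ U] :
    ∃ F : Quotient (UltraUrysohn.UnitaryRep.setoid.{u, v} U) →
        Quotient (UltraUrysohn.StarRep.setoid.{u, v} Λ U),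
      (∀ (e : ∀ X : UltraUrysohn.KObj.{u} Λ, UltraUrysohn.IsoEmb X U)
        (ρ : UltraUrysohn.UnitaryRep.{u, v} U),
        ∃ τ : UltraUrysohn.StarRep.{u, v} Λ U,
          UltraUrysohn.IsReduction e ρ τ.toOperatorFamily ∧
          F (Quotient.mk _ ρ) = Quotient.mk _ τ) ∧
      Function.Bijective F := by
  let e₀ : ∀ X : UltraUrysohn.KObj.{u} Λ, UltraUrysohn.IsoEmb X U := fun X =>
    Classical.choice (UltraUrysohn.IsUrysohn.nonempty_isoEmb X)
  refine ⟨Quotient.map (fun ρ => ρ.reduction e₀) fun ρ ρ' h =>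
    UltraUrysohn.UnitaryRep.reduction_equiv h e₀ e₀, fun e ρ => ⟨ρ.reduction e,
      ρ.isReduction_reduction e, Quotient.sound
        (UltraUrysohn.UnitaryRep.reduction_equiv (Setoid.refl ρ) e₀ e)⟩, ?_, ?_⟩
  · intro x y h
    induction x using Quotient.inductionOn with | _ ρ
    induction y using Quotient.inductionOn with | _ ρ'
    exact Quotient.sound (UltraUrysohn.UnitaryRep.equiv_of_reduction_equiv e₀ (Quotient.exact h))
  · intro y
    induction y using Quotient.inductionOn with | _ τ
    obtain ⟨ρ, hρ⟩ := τ.exists_reduction_equiv e₀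
    exact ⟨Quotient.mk _ ρ, Quotient.sound hρ⟩
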